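/- For $m\ge 1$ let $\delta(m)$ be given by $\delta(m)=1,2,4,4,8,8,8,8$ for $m=1,\dots,8$ and $\delta(m+8)=16\,\delta(m)$. A Clifford system on $\mathbb{R}^{2l}$ is a tuple $(P_0,\dots,P_m)$ of symmetric real $2l\times 2l$ matrices with $P_i^2=I$ and $P_iP_j=-P_jP_i$ for $i\ne j$. Put $H(x)=\sum_{i=0}^m (x^TP_ix)^2$; the FKM foliation of the Clifford system is the partition of the unit sphere $S^{2l-1}\subset\mathbb{R}^{2l}$ into the nonempty level sets of $H$, and its Clifford--Stiefel variety is $M_+=\{x\in S^{2l-1} : H(x)=0\}$. For a submanifold $M^n\subset\mathbb{R}^d$ with the induced metric and second fundamental form $I\!I$, for $p\in M$ and orthonormal $X,N\in T_pM$, put $$\operatorname{ACS}(X,N)=\sum_{k=1}^{n-1}\bigl(\|I\!I(e_k,X)\|^2+\|I\!I(e_k,N)\|^2\bigr)-\sum_{k=1}^{n-1}R^M(e_k,X,e_k,X)-\operatorname{Ric}^M(N,N),$$ where $e_1,\dots,e_{n-1}$ is an orthonormal basis of $N^\perp\subset T_pM$, and $R^M$ is the curvature tensor with the sign for which $R^M(v,w,v,w)$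 is the sectional curvature of orthonormal $v,w$. One says that $M$ has $\operatorname{ACS}<0$ if $\operatorname{ACS}(X,N)<0$ for all $p\in M$ and all orthonormal $X,N\in T_pM$. (1) Let $m\ge1$ and let $(P_0,\dots,P_m)$ be a Clifford system on $\mathbb{R}^{2l}$ with $l=k\,\delta(m)$ and $k>\frac{7m+14}{4\delta(m)}$. Then $M_+$ is a nonempty smooth embedded submanifold of $\mathbb{R}^{2l}$ of dimension $2l-m-2$, and it has $\operatorname{ACS}<0$. (2) This covers all but finitely many FKM foliations, up to congruence: there is a finite list of FKM foliations such that, whenever $m,l\ge1$ and $(P_0,\dots,P_m)$ is a Clifford system on $\mathbb{R}^{2l}$ for which there is no $k$ with $l=k\,\delta(m)$ and $k>\frac{7m+14}{4\delta(m)}$, some linear isometry maps the leaves of its FKM foliation onto the leaves of a foliation in the list. -/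

import Mathlib

open scoped ContDiff Matrix

noncomputable section

namespace FKM

/-! ### Local Riemannian geometry of an immersion `φ : ℝⁿ ⊇ U → E`

All tensors below are written in the coordinates `u = (u_0, …, u_{n-1})` of the parameter domain.
A vector `x : ℝⁿ` stands for the tangent vector `dφ_u(x)` of the image. -/

section Immersion

variable {n : ℕ} {E : Type*} [NormedAddCommGroup E] [InnerProductSpace ℝ E]

/-- The partial derivative `∂_i f` of a real function on `ℝⁿ`. -/
def partialDeriv (i : Fin n) (f : EuclideanSpace ℝ (Fin n) → ℝ)
    (u : EuclideanSpace ℝ (Fin n)) : ℝ :=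
  fderiv ℝ f u (EuclideanSpace.single i 1)

/-- The metric induced by `φ` (first fundamental form): `g_u(x, y) = ⟨dφ_u(x), dφ_u(y)⟩`. -/
def inducedMetric (φ : EuclideanSpace ℝ (Fin n) → E) (u x y : EuclideanSpace ℝ (Fin n)) : ℝ :=
  inner ℝ (fderiv ℝ φ u x) (fderiv ℝ φ u y)

/-- The matrix `g_{ij}(u)` of the induced metric. -/
def metricMatrix (φ : EuclideanSpace ℝ (Fin n) → E) (u : EuclideanSpace ℝ (Fin n)) :
    Matrix (Fin n) (Fin n) ℝ :=
  Matrix.of fun i j =>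
    inducedMetric φ u (EuclideanSpace.single i 1) (EuclideanSpace.single j 1)

/-- The Christoffel symbols
`Γ^p_{ij} = ½ ∑_q g^{pq} (∂_i g_{jq} + ∂_j g_{iq} - ∂_q g_{ij})` of the Levi-Civita connection
of the induced metric. -/
def christoffel (φ : EuclideanSpace ℝ (Fin n) → E) (p i j : Fin n)
    (u : EuclideanSpace ℝ (Fin n)) : ℝ :=
  (1 / 2) * ∑ q, (metricMatrix φ u)⁻¹ p q *
    (partialDeriv i (fun v => metricMatrix φ v j q) u
      + partialDeriv j (fun v => metricMatrix φ v i q) u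
      - partialDeriv q (fun v => metricMatrix φ v i j) u)

/-- The components of the curvature operator `R(X,Y)Z = ∇_X ∇_Y Z - ∇_Y ∇_X Z - ∇_{[X,Y]} Z`:
`curvatureCoeff φ p i j k` is the `p`-th component of `R(∂_i, ∂_j) ∂_k`. -/
def curvatureCoeff (φ : EuclideanSpace ℝ (Fin n) → E) (p i j k : Fin n)
    (u : EuclideanSpace ℝ (Fin n)) : ℝ :=
  partialDeriv i (christoffel φ p j k) u - partialDeriv j (christoffel φ p i k) u
    + ∑ q, (christoffel φ q j k u * christoffel φ p i q u
      - christoffel φ q i k u * christoffel φ p j q u)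

/-- The curvature tensor `R(x,y,z,w) = ⟨R(x,y)w, z⟩` of the induced metric, with the sign
convention for which `R(v,w,v,w)` is a positive multiple of the sectional curvature. -/
def riemann (φ : EuclideanSpace ℝ (Fin n) → E) (u x y z w : EuclideanSpace ℝ (Fin n)) : ℝ :=
  ∑ i, ∑ j, ∑ k, ∑ p, ∑ q,
    x i * y j * w k * z q * curvatureCoeff φ p i j k u * metricMatrix φ u p q

/-- The Ricci tensor of the induced metric: `Ric(y,z)` is the trace of `x ↦ R(x,y)z`. -/
def ricci (φ : EuclideanSpace ℝ (Fin n) → E) (u y z : EuclideanSpace ℝ (Fin n)) : ℝ :=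
  ∑ i, ∑ j, ∑ k, y j * z k * curvatureCoeff φ i i j k u

/-- The tangent space `dφ_u(ℝⁿ)` of the immersion. -/
def tangentSpan (φ : EuclideanSpace ℝ (Fin n) → E) (u : EuclideanSpace ℝ (Fin n)) :
    Submodule ℝ E :=
  LinearMap.range (fderiv ℝ φ u : EuclideanSpace ℝ (Fin n) →ₗ[ℝ] E)

/-- The second fundamental form: the component of `D²φ_u(x, y)` normal to the tangent space. -/
def secondFundamentalForm [FiniteDimensional ℝ E] (φ : EuclideanSpace ℝ (Fin n) → E)
    (u x y : EuclideanSpace ℝ (Fin n)) : E :=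
  (tangentSpan φ u)ᗮ.starProjection (fderiv ℝ (fderiv ℝ φ) u x y)

/-- `e` is an orthonormal basis, for the induced metric, of the hyperplane `N^⊥` of the tangent
space (`n - 1` orthonormal vectors in an `(n-1)`-dimensional space). -/
def IsOrthonormalBasisOfPerp (φ : EuclideanSpace ℝ (Fin n) → E)
    (u N : EuclideanSpace ℝ (Fin n)) (e : Fin (n - 1) → EuclideanSpace ℝ (Fin n)) : Prop :=
  (∀ i j, inducedMetric φ u (e i) (e j) = if i = j then 1 else 0) ∧
    ∀ i, inducedMetric φ u (e i) N = 0

/-- The ACS quantity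
`∑_k (‖II(e_k,X)‖² + ‖II(e_k,N)‖²) - ∑_k R(e_k,X,e_k,X) - Ric(N,N)`,
where `e` is an orthonormal basis of `N^⊥`. -/
def acs [FiniteDimensional ℝ E] (φ : EuclideanSpace ℝ (Fin n) → E)
    (u X N : EuclideanSpace ℝ (Fin n)) (e : Fin (n - 1) → EuclideanSpace ℝ (Fin n)) : ℝ :=
  (∑ k, (‖secondFundamentalForm φ u (e k) X‖ ^ 2 + ‖secondFundamentalForm φ u (e k) N‖ ^ 2))
    - (∑ k, riemann φ u (e k) X (e k) X) - ricci φ u N N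

/-- `φ : U → M` is a smooth local parametrization of the subset `M` of `E`: a smooth immersion on
the open set `U ⊆ ℝⁿ` which is a homeomorphism onto a relatively open subset of `M`. -/
structure IsLocalParametrization (M : Set E) (U : Set (EuclideanSpace ℝ (Fin n)))
    (φ : EuclideanSpace ℝ (Fin n) → E) : Prop where
  isOpen : IsOpen U
  contDiffOn : ContDiffOn ℝ ∞ φ U
  immersion : ∀ u ∈ U, Function.Injective (fderiv ℝ φ u)
  injOn : Set.InjOn φ U
  isOpenMap : ∀ O ⊆ U, IsOpen O → ∃ W : Set E, IsOpen W ∧ φ '' O = M ∩ W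

end Immersion

/-- `M` is a smooth embedded `n`-dimensional submanifold of `E`. -/
def IsSmoothSubmanifold {E : Type*} [NormedAddCommGroup E] [InnerProductSpace ℝ E]
    (n : ℕ) (M : Set E) : Prop :=
  ∀ p ∈ M, ∃ (U : Set (EuclideanSpace ℝ (Fin n))) (φ : EuclideanSpace ℝ (Fin n) → E),
    IsLocalParametrization M U φ ∧ p ∈ φ '' U

/-- The embedded submanifold `M` of `E`, with the induced metric, satisfies `ACS < 0`: at each
point, `ACS(X, N) < 0` for every pair of orthonormal tangent vectors. -/
def ACSNegative {E : Type*} [NormedAddCommGroup E] [InnerProductSpace ℝ E]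
    [FiniteDimensional ℝ E] (n : ℕ) (M : Set E) : Prop :=
  ∀ (U : Set (EuclideanSpace ℝ (Fin n))) (φ : EuclideanSpace ℝ (Fin n) → E),
    IsLocalParametrization M U φ → ∀ u ∈ U, ∀ X N : EuclideanSpace ℝ (Fin n),
      inducedMetric φ u X X = 1 → inducedMetric φ u N N = 1 → inducedMetric φ u X N = 0 →
      ∀ e : Fin (n - 1) → EuclideanSpace ℝ (Fin n), IsOrthonormalBasisOfPerp φ u N e →
        acs φ u X N e < 0

/-! ### Clifford systems and FKM foliations -/

/-- A Clifford system `(P_0, …, P_m)` on `ℝ^{2l}`. -/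
structure IsCliffordSystem {m l : ℕ}
    (P : Fin (m + 1) → Matrix (Fin (2 * l)) (Fin (2 * l)) ℝ) : Prop where
  isSymm : ∀ i, (P i).IsSymm
  sq_eq_one : ∀ i, P i * P i = 1
  anticomm : ∀ i j, i ≠ j → P i * P j = -(P j * P i)

/-- The numbers `δ(m)`, `m ≥ 1`: `1, 2, 4, 4, 8, 8, 8, 8` for `m = 1, …, 8`, and
`δ(m + 8) = 16 δ(m)`. The value at `0` is irrelevant. -/
def delta : ℕ → ℕ
  | 0 => 1
  | 1 => 1
  | 2 => 2
  | 3 => 4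
  | 4 => 4
  | 5 => 8
  | 6 => 8
  | 7 => 8
  | 8 => 8
  | n + 9 => 16 * delta (n + 1)

/-- The polynomial `H(x) = ∑_i (xᵀ P_i x)²`. -/
def fkmPolynomial {m l : ℕ} (P : Fin (m + 1) → Matrix (Fin (2 * l)) (Fin (2 * l)) ℝ)
    (x : EuclideanSpace ℝ (Fin (2 * l))) : ℝ :=
  ∑ i, (x.ofLp ⬝ᵥ (P i *ᵥ x.ofLp)) ^ 2

/-- The level set `H⁻¹(c)` in the unit sphere `S^{2l-1}`. -/
def levelSet {m l : ℕ} (P : Fin (m + 1) → Matrix (Fin (2 * l)) (Fin (2 * l)) ℝ) (c : ℝ) :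
    Set (EuclideanSpace ℝ (Fin (2 * l))) :=
  {x | x ∈ Metric.sphere (0 : EuclideanSpace ℝ (Fin (2 * l))) 1 ∧ fkmPolynomial P x = c}

/-- The Clifford-Stiefel variety `M_+ = H⁻¹(0) ⊆ S^{2l-1}`. -/
def cliffordStiefel {m l : ℕ} (P : Fin (m + 1) → Matrix (Fin (2 * l)) (Fin (2 * l)) ℝ) :
    Set (EuclideanSpace ℝ (Fin (2 * l))) :=
  levelSet P 0

/-- The data of an FKM foliation: a Clifford system `(P_0, …, P_m)` on `ℝ^{2l}`, with `m ≥ 1`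
and `l ≥ 1`. -/
structure Foliation where
  m : ℕ
  l : ℕ
  one_le_m : 1 ≤ m
  one_le_l : 1 ≤ l
  P : Fin (m + 1) → Matrix (Fin (2 * l)) (Fin (2 * l)) ℝ
  isCliffordSystem : IsCliffordSystem P

/-- The leaves of the foliation of `S^{2l-1}`: the nonempty level sets of `H`. -/
def Foliation.leaves (F : Foliation) : Set (Set (EuclideanSpace ℝ (Fin (2 * F.l)))) :=
  {L | L.Nonempty ∧ ∃ c : ℝ, L = levelSet F.P c}

/-- Two FKM foliations are congruent if a linear isometry maps the leaves of one onto the leaves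
of the other. -/
def Foliation.Congruent (F G : Foliation) : Prop :=
  ∃ A : EuclideanSpace ℝ (Fin (2 * F.l)) ≃ₗᵢ[ℝ] EuclideanSpace ℝ (Fin (2 * G.l)),
    (fun L => A '' L) '' F.leaves = G.leaves

/-- The numerical condition: `l = k δ(m)` with `k > (7m + 14) / (4 δ(m))`. -/
def InRange (m l k : ℕ) : Prop :=
  l = k * delta m ∧ (k : ℝ) > (7 * (m : ℝ) + 14) / (4 * (delta m : ℝ))

end FKM

end

/-! (1) Write `A_i` for `P_i` acting on `ℝ^{2l}` and add the identity as one more member, so that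
the unit sphere and the `m + 1` quadrics are treated alike. At a point `x` of `M_+` the Clifford
relations make `x, A_0 x, …, A_m x` orthonormal. Differentiating the constraints shows that they
span the normal space and that `II(X,Y) = -∑_a ⟨A_a X, Y⟩ A_a x`. The Gauss equation then splits
`ACS(X,N)` into one sum per normal direction. The direction `x` contributes at most `4 - 2n`, where
`n = dim M_+`. For each `A_i`, Bessel's inequality bounds the squared terms, and `tr A_i = 0`
evaluates the sum of `⟨A_i e_k, e_k⟩` over the frame as `-⟨A_i N, N⟩`. With `t = ⟨A_i N, N⟩` and `s
= ⟨A_i X, X⟩` the contribution is at most `4 - t² + st ≤ 17/4`. The total is negative once `16 +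
17(m + 1) < 8n`, which the numerical condition implies (`acsNegative_stiefel`). Nonemptiness is
linear algebra with the eigenspaces of one `A_i`; smoothness is the inverse function theorem.

(2) Representation theory gives `δ(m) ∣ l` (`IsCliffordSystem.delta_dvd`), so an excluded foliation
has `4 δ(m) ≤ 4l ≤ 7m + 14`. The exponential growth of `δ` leaves only finitely many pairs `(m, l)`.
For a fixed pair the Clifford systems form a compact set on which nearby systems are orthogonally
conjugate (`eventually_orthogonallyConjugate`), so there are finitely many classes; conjugate
systems have congruent foliations. -/

open scoped ContDiff Matrix

noncomputable section

namespace FKM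

/-! ### Christoffel symbols, second fundamental form and Gauss equation in coordinates. -/

section GaussEquation

variable {n : ℕ} {E : Type*} [NormedAddCommGroup E] [InnerProductSpace ℝ E]

/-- The first partial derivative `∂_i φ`. -/
def partialOne (φ : EuclideanSpace ℝ (Fin n) → E) (i : Fin n) (v : EuclideanSpace ℝ (Fin n)) : E :=
  fderiv ℝ φ v (EuclideanSpace.single i 1)

/-- The second partial derivative `∂_i ∂_j φ`. -/
def partialTwo (φ : EuclideanSpace ℝ (Fin n) → E) (i j : Fin n)
    (v : EuclideanSpace ℝ (Fin n)) : E :=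
  fderiv ℝ (fderiv ℝ φ) v (EuclideanSpace.single i 1) (EuclideanSpace.single j 1)

variable {φ : EuclideanSpace ℝ (Fin n) → E} {U : Set (EuclideanSpace ℝ (Fin n))}
  {u : EuclideanSpace ℝ (Fin n)}

theorem euclidean_eq_sum_single (x : EuclideanSpace ℝ (Fin n)) :
    x = ∑ i, x i • EuclideanSpace.single i (1 : ℝ) := by
  ext j
  simp [Finset.sum_apply, Pi.single_apply]

theorem contDiffAt_fderiv {F G : Type*} [NormedAddCommGroup F] [NormedSpace ℝ F]
    [NormedAddCommGroup G] [NormedSpace ℝ G] {f : F → G} {x : F} (h : ContDiffAt ℝ ∞ f x) :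
    ContDiffAt ℝ ∞ (fderiv ℝ f) x :=
  h.fderiv_right (m := ∞) (by simp)

theorem contDiffAt_partialOne (h : ContDiffAt ℝ ∞ φ u) (i : Fin n) :
    ContDiffAt ℝ ∞ (partialOne φ i) u :=
  (contDiffAt_fderiv h).clm_apply contDiffAt_const

theorem contDiffAt_partialTwo (h : ContDiffAt ℝ ∞ φ u) (i j : Fin n) :
    ContDiffAt ℝ ∞ (partialTwo φ i j) u :=
  ((contDiffAt_fderiv (contDiffAt_fderiv h)).clm_apply contDiffAt_const).clm_apply
    contDiffAt_const

theorem partialTwo_eq_fderiv_partialOne (h : ContDiffAt ℝ ∞ φ u) (i j : Fin n) :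
    fderiv ℝ (partialOne φ j) u (EuclideanSpace.single i 1) = partialTwo φ i j u := by
  unfold partialOne partialTwo
  have h1 : DifferentiableAt ℝ (fderiv ℝ φ) u := (contDiffAt_fderiv h).differentiableAt (by simp)
  rw [fderiv_clm_apply h1 (differentiableAt_const _)]
  simp

theorem partialTwo_comm (h : ContDiffAt ℝ ∞ φ u) (i j : Fin n) :
    partialTwo φ i j u = partialTwo φ j i u :=
  h.isSymmSndFDerivAt (by simpa using ENat.LEInfty.out) _ _

/-- Near `u` the function `∂_a ∂_k φ` is a first partial of `∂_k φ`, so Schwarz's theorem applies to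
`∂_k φ`. -/
theorem fderiv_partialTwo_comm (hU : IsOpen U) (hφ : ContDiffOn ℝ ∞ φ U) (hu : u ∈ U)
    (i j k : Fin n) :
    fderiv ℝ (partialTwo φ j k) u (EuclideanSpace.single i 1) =
      fderiv ℝ (partialTwo φ i k) u (EuclideanSpace.single j 1) := by
  have key : ∀ a : Fin n, fderiv ℝ (partialTwo φ a k) u =
      fderiv ℝ (partialOne (partialOne φ k) a) u := by
    intro a
    apply Filter.EventuallyEq.fderiv_eq
    filter_upwards [hU.mem_nhds hu] with v hv
    exact (partialTwo_eq_fderiv_partialOne (hφ.contDiffAt (hU.mem_nhds hv)) a k).symm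
  have h1 := contDiffAt_partialOne (hφ.contDiffAt (hU.mem_nhds hu)) k
  rw [key, key, partialTwo_eq_fderiv_partialOne h1, partialTwo_eq_fderiv_partialOne h1,
    partialTwo_comm h1]

theorem metricMatrix_apply (v : EuclideanSpace ℝ (Fin n)) (i j : Fin n) :
    metricMatrix φ v i j = inner ℝ (partialOne φ i v) (partialOne φ j v) := rfl

theorem metricMatrix_comm (v : EuclideanSpace ℝ (Fin n)) (i j : Fin n) :
    metricMatrix φ v i j = metricMatrix φ v j i := by
  rw [metricMatrix_apply, metricMatrix_apply, real_inner_comm]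

theorem fderiv_eq_sum_partialOne (v x : EuclideanSpace ℝ (Fin n)) :
    fderiv ℝ φ v x = ∑ i, x i • partialOne φ i v := by
  conv_lhs => rw [euclidean_eq_sum_single x]
  simp [partialOne]

theorem inducedMetric_eq_sum (v x y : EuclideanSpace ℝ (Fin n)) :
    inducedMetric φ v x y = ∑ i, ∑ j, x i * y j * metricMatrix φ v i j := by
  unfold inducedMetric
  rw [fderiv_eq_sum_partialOne, fderiv_eq_sum_partialOne, sum_inner]
  refine Finset.sum_congr rfl fun i _ => ?_
  rw [inner_sum]
  refine Finset.sum_congr rfl fun j _ => ?_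
  rw [inner_smul_left, inner_smul_right, metricMatrix_apply]
  simp [mul_assoc]

theorem isUnit_det_metricMatrix (h : Function.Injective (fderiv ℝ φ u)) :
    IsUnit (metricMatrix φ u).det := by
  rw [isUnit_iff_ne_zero]
  intro h0
  obtain ⟨c, hc, hc0⟩ := Matrix.exists_mulVec_eq_zero_iff.2 h0
  apply hc
  have h1 : inducedMetric φ u (WithLp.toLp 2 c) (WithLp.toLp 2 c) = 0 := by
    rw [inducedMetric_eq_sum]
    apply Finset.sum_eq_zero
    intro i _
    have := congrFun hc0 i
    simp only [Matrix.mulVec, dotProduct, Pi.zero_apply] at this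
    have h2 : ∑ j, c i * c j * metricMatrix φ u i j = c i * ∑ j, metricMatrix φ u i j * c j := by
      rw [Finset.mul_sum]; exact Finset.sum_congr rfl fun j _ => by ring
    simpa [this] using h2
  unfold inducedMetric at h1
  rw [inner_self_eq_zero] at h1
  have h2 := h (h1.trans (map_zero _).symm)
  simpa using congrArg WithLp.ofLp h2

theorem partialDeriv_inner {f g : EuclideanSpace ℝ (Fin n) → E} (hf : DifferentiableAt ℝ f u)
    (hg : DifferentiableAt ℝ g u) (i : Fin n) :
    partialDeriv i (fun v => inner ℝ (f v) (g v)) u =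
      inner ℝ (f u) (fderiv ℝ g u (EuclideanSpace.single i 1)) +
        inner ℝ (fderiv ℝ f u (EuclideanSpace.single i 1)) (g u) :=
  fderiv_inner_apply ℝ hf hg _

theorem partialDeriv_metricMatrix (h : ContDiffAt ℝ ∞ φ u) (k i j : Fin n) :
    partialDeriv k (fun v => metricMatrix φ v i j) u =
      inner ℝ (partialOne φ i u) (partialTwo φ k j u) +
        inner ℝ (partialTwo φ k i u) (partialOne φ j u) := by
  simp only [metricMatrix_apply]
  rw [partialDeriv_inner ((contDiffAt_partialOne h i).differentiableAt (by simp))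
    ((contDiffAt_partialOne h j).differentiableAt (by simp)),
    partialTwo_eq_fderiv_partialOne h, partialTwo_eq_fderiv_partialOne h]

/-- Once the metric derivatives are expanded by the product rule, four of the six terms cancel, as
in the Koszul formula. -/
theorem christoffel_eq (h : ContDiffAt ℝ ∞ φ u) (p i j : Fin n) :
    christoffel φ p i j u =
      ∑ q, (metricMatrix φ u)⁻¹ p q * inner ℝ (partialTwo φ i j u) (partialOne φ q u) := by
  unfold christoffel
  rw [Finset.mul_sum]
  refine Finset.sum_congr rfl fun q _ => ?_
  rw [partialDeriv_metricMatrix h, partialDeriv_metricMatrix h, partialDeriv_metricMatrix h,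
    partialTwo_comm h j i, partialTwo_comm h q i, partialTwo_comm h q j,
    real_inner_comm (partialTwo φ i q u), real_inner_comm (partialTwo φ j q u)]
  ring

theorem sum_christoffel_mul_metricMatrix (h : ContDiffAt ℝ ∞ φ u)
    (hi : Function.Injective (fderiv ℝ φ u)) (i j q : Fin n) :
    ∑ p, christoffel φ p i j u * metricMatrix φ u p q =
      inner ℝ (partialTwo φ i j u) (partialOne φ q u) := by
  have h1 : (metricMatrix φ u)ᵀ = metricMatrix φ u := by
    ext a b; exact metricMatrix_comm u b a
  have h2 : ∀ p, christoffel φ p i j u = ((metricMatrix φ u)⁻¹ *ᵥ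
      fun r => inner ℝ (partialTwo φ i j u) (partialOne φ r u)) p := by
    intro p; rw [christoffel_eq h]; rfl
  have h3 : ∑ p, christoffel φ p i j u * metricMatrix φ u p q =
      (metricMatrix φ u *ᵥ ((metricMatrix φ u)⁻¹ *ᵥ
      fun r => inner ℝ (partialTwo φ i j u) (partialOne φ r u))) q := by
    simp only [h2]
    rw [Matrix.mulVec, dotProduct]
    exact Finset.sum_congr rfl fun p _ => by rw [metricMatrix_comm, mul_comm]
  rw [h3, Matrix.mulVec_mulVec, Matrix.mul_nonsing_inv _ (isUnit_det_metricMatrix hi),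
    Matrix.one_mulVec]

theorem differentiableAt_det {ι : Type*} [Fintype ι] [DecidableEq ι] {F : Type*}
    [NormedAddCommGroup F] [NormedSpace ℝ F] {A : F → Matrix ι ι ℝ} {x : F}
    (h : ∀ i j, DifferentiableAt ℝ (fun v => A v i j) x) :
    DifferentiableAt ℝ (fun v => (A v).det) x := by
  simp only [Matrix.det_apply]
  refine DifferentiableAt.fun_sum fun σ _ => ?_
  refine DifferentiableAt.const_smul ?_ _
  exact (HasFDerivAt.finsetProd fun i _ => (h _ _).hasFDerivAt).differentiableAt

theorem differentiableAt_nonsing_inv {ι : Type*} [Fintype ι] [DecidableEq ι] {F : Type*}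
    [NormedAddCommGroup F] [NormedSpace ℝ F] {A : F → Matrix ι ι ℝ} {x : F}
    (h : ∀ i j, DifferentiableAt ℝ (fun v => A v i j) x) (hx : IsUnit (A x).det) (i j : ι) :
    DifferentiableAt ℝ (fun v => (A v)⁻¹ i j) x := by
  simp only [Matrix.inv_def, Ring.inverse_eq_inv', Matrix.smul_apply, smul_eq_mul,
    Matrix.adjugate_apply]
  refine ((differentiableAt_det h).inv hx.ne_zero).mul (differentiableAt_det fun a b => ?_)
  simp only [Matrix.updateRow_apply]
  split_ifs
  · exact differentiableAt_const _
  · exact h a b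

theorem differentiableAt_metricMatrix (h : ContDiffAt ℝ ∞ φ u) (i j : Fin n) :
    DifferentiableAt ℝ (fun v => metricMatrix φ v i j) u :=
  ((contDiffAt_partialOne h i).differentiableAt (by simp)).inner ℝ
    ((contDiffAt_partialOne h j).differentiableAt (by simp))

theorem differentiableAt_christoffel (hU : IsOpen U) (hφ : ContDiffOn ℝ ∞ φ U) (hu : u ∈ U)
    (hi : Function.Injective (fderiv ℝ φ u)) (p i j : Fin n) :
    DifferentiableAt ℝ (christoffel φ p i j) u := by
  have hc := hφ.contDiffAt (hU.mem_nhds hu)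
  have h1 : christoffel φ p i j =ᶠ[nhds u] fun v =>
      ∑ q, (metricMatrix φ v)⁻¹ p q * inner ℝ (partialTwo φ i j v) (partialOne φ q v) := by
    filter_upwards [hU.mem_nhds hu] with v hv
    exact christoffel_eq (hφ.contDiffAt (hU.mem_nhds hv)) p i j
  rw [h1.differentiableAt_iff]
  refine DifferentiableAt.fun_sum fun q _ => ?_
  refine (differentiableAt_nonsing_inv (fun a b => differentiableAt_metricMatrix hc a b)
    (isUnit_det_metricMatrix hi) p q).mul ?_
  exact ((contDiffAt_partialTwo hc i j).differentiableAt (by simp)).inner ℝ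
    ((contDiffAt_partialOne hc q).differentiableAt (by simp))

/-- The component of `∂_j ∂_k φ` normal to the immersion. -/
def normalPart (φ : EuclideanSpace ℝ (Fin n) → E) (j k : Fin n)
    (u : EuclideanSpace ℝ (Fin n)) : E :=
  partialTwo φ j k u - ∑ p, christoffel φ p j k u • partialOne φ p u

theorem inner_normalPart_partialOne (h : ContDiffAt ℝ ∞ φ u)
    (hi : Function.Injective (fderiv ℝ φ u)) (j k q : Fin n) :
    inner ℝ (normalPart φ j k u) (partialOne φ q u) = 0 := by
  rw [normalPart, inner_sub_left, sum_inner, ← sum_christoffel_mul_metricMatrix h hi, sub_eq_zero]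
  exact Finset.sum_congr rfl fun p _ => by rw [inner_smul_left]; rfl

theorem inner_normalPart_partialTwo (h : ContDiffAt ℝ ∞ φ u)
    (hi : Function.Injective (fderiv ℝ φ u)) (j k a b : Fin n) :
    inner ℝ (normalPart φ j k u) (partialTwo φ a b u) =
      inner ℝ (normalPart φ j k u) (normalPart φ a b u) := by
  conv_rhs => rw [normalPart.eq_1 φ a b, inner_sub_right, inner_sum]
  simp [inner_smul_right, inner_normalPart_partialOne h hi]

/-- Obtained by differentiating `∑_p Γ^p_{jk} g_{pq} = ⟨∂_j ∂_k φ, ∂_q φ⟩` in a neighbourhood, which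
avoids differentiating the inverse metric explicitly. -/
theorem sum_partialDeriv_christoffel (hU : IsOpen U) (hφ : ContDiffOn ℝ ∞ φ U)
    (hi : ∀ v ∈ U, Function.Injective (fderiv ℝ φ v)) (hu : u ∈ U) (i j k q : Fin n) :
    ∑ p, partialDeriv i (christoffel φ p j k) u * metricMatrix φ u p q =
      inner ℝ (fderiv ℝ (partialTwo φ j k) u (EuclideanSpace.single i 1)) (partialOne φ q u)
        + inner ℝ (normalPart φ j k u) (partialTwo φ i q u)
        - ∑ p, christoffel φ p j k u * inner ℝ (partialTwo φ i p u) (partialOne φ q u) := by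
  have hc := hφ.contDiffAt (hU.mem_nhds hu)
  have h1 : (fun v => ∑ p, christoffel φ p j k v * metricMatrix φ v p q) =ᶠ[nhds u]
      fun v => inner ℝ (partialTwo φ j k v) (partialOne φ q v) := by
    filter_upwards [hU.mem_nhds hu] with v hv
    exact sum_christoffel_mul_metricMatrix (hφ.contDiffAt (hU.mem_nhds hv)) (hi v hv) j k q
  have h2 : partialDeriv i (fun v => ∑ p, christoffel φ p j k v * metricMatrix φ v p q) u =
      partialDeriv i (fun v => inner ℝ (partialTwo φ j k v) (partialOne φ q v)) u := by
    unfold partialDeriv; rw [h1.fderiv_eq]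
  rw [partialDeriv_inner ((contDiffAt_partialTwo hc j k).differentiableAt (by simp))
    ((contDiffAt_partialOne hc q).differentiableAt (by simp)),
    partialTwo_eq_fderiv_partialOne hc] at h2
  have h3 : partialDeriv i (fun v => ∑ p, christoffel φ p j k v * metricMatrix φ v p q) u =
      ∑ p, (christoffel φ p j k u * partialDeriv i (fun v => metricMatrix φ v p q) u
        + partialDeriv i (christoffel φ p j k) u * metricMatrix φ u p q) := by
    unfold partialDeriv
    have hd := fun p => differentiableAt_christoffel hU hφ hu (hi u hu) p j k
    have hm := HasFDerivAt.fun_sum (u := Finset.univ) fun p _ =>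
      ((hd p).hasFDerivAt.fun_mul (differentiableAt_metricMatrix hc p q).hasFDerivAt)
    rw [hm.fderiv, sum_apply]
    refine Finset.sum_congr rfl fun p _ => ?_
    simp [mul_comm]
  rw [h3, Finset.sum_add_distrib] at h2
  simp only [partialDeriv_metricMatrix hc, mul_add, Finset.sum_add_distrib] at h2
  have h4 : inner ℝ (normalPart φ j k u) (partialTwo φ i q u) =
      inner ℝ (partialTwo φ j k u) (partialTwo φ i q u) -
        ∑ p, christoffel φ p j k u * inner ℝ (partialOne φ p u) (partialTwo φ i q u) := by
    rw [normalPart, inner_sub_left, sum_inner]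
    simp [inner_smul_left]
  linarith

/-- The Gauss equation in coordinates. -/
theorem sum_curvatureCoeff_mul_metricMatrix (hU : IsOpen U) (hφ : ContDiffOn ℝ ∞ φ U)
    (hi : ∀ v ∈ U, Function.Injective (fderiv ℝ φ v)) (hu : u ∈ U) (i j k q : Fin n) :
    ∑ p, curvatureCoeff φ p i j k u * metricMatrix φ u p q =
      inner ℝ (normalPart φ j k u) (normalPart φ i q u) -
        inner ℝ (normalPart φ i k u) (normalPart φ j q u) := by
  have hc := hφ.contDiffAt (hU.mem_nhds hu)
  have h1 : ∀ a b c : Fin n, ∑ p, (∑ r, christoffel φ r b c u * christoffel φ p a r u) *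
      metricMatrix φ u p q =
      ∑ r, christoffel φ r b c u * inner ℝ (partialTwo φ a r u) (partialOne φ q u) := by
    intro a b c
    simp only [Finset.sum_mul]
    rw [Finset.sum_comm]
    refine Finset.sum_congr rfl fun r _ => ?_
    rw [← sum_christoffel_mul_metricMatrix hc (hi u hu), Finset.mul_sum]
    exact Finset.sum_congr rfl fun p _ => by ring
  have h2 : ∑ p, curvatureCoeff φ p i j k u * metricMatrix φ u p q =
      ∑ p, partialDeriv i (christoffel φ p j k) u * metricMatrix φ u p q
      - ∑ p, partialDeriv j (christoffel φ p i k) u * metricMatrix φ u p q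
      + (∑ p, (∑ r, christoffel φ r j k u * christoffel φ p i r u) * metricMatrix φ u p q
      - ∑ p, (∑ r, christoffel φ r i k u * christoffel φ p j r u) * metricMatrix φ u p q) := by
    simp only [← Finset.sum_sub_distrib, ← Finset.sum_add_distrib]
    refine Finset.sum_congr rfl fun p _ => ?_
    unfold curvatureCoeff
    rw [Finset.sum_sub_distrib]
    ring
  -- The third derivatives cancel by symmetry in `i, j`, and the `ΓΓ` terms cancel those produced by
  -- differentiating the metric; only products of normal parts remain.
  rw [h2, h1, h1, sum_partialDeriv_christoffel hU hφ hi hu,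
    sum_partialDeriv_christoffel hU hφ hi hu, fderiv_partialTwo_comm hU hφ hu i j k,
    inner_normalPart_partialTwo hc (hi u hu), inner_normalPart_partialTwo hc (hi u hu)]
  ring

theorem secondFundamentalForm_single [FiniteDimensional ℝ E] (h : ContDiffAt ℝ ∞ φ u)
    (hi : Function.Injective (fderiv ℝ φ u)) (i j : Fin n) :
    secondFundamentalForm φ u (EuclideanSpace.single i 1) (EuclideanSpace.single j 1) =
      normalPart φ i j u := by
  unfold secondFundamentalForm
  have h1 : normalPart φ i j u ∈ (tangentSpan φ u)ᗮ := by
    rw [Submodule.mem_orthogonal']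
    rintro _ ⟨x, rfl⟩
    simp only [ContinuousLinearMap.coe_coe]
    rw [fderiv_eq_sum_partialOne, inner_sum]
    simp [inner_smul_right, inner_normalPart_partialOne h hi]
  have h2 : ∑ p, christoffel φ p i j u • partialOne φ p u ∈ (tangentSpan φ u)ᗮᗮ := by
    apply Submodule.le_orthogonal_orthogonal
    exact Submodule.sum_mem _ fun p _ => Submodule.smul_mem _ _ ⟨_, rfl⟩
  have h3 : fderiv ℝ (fderiv ℝ φ) u (EuclideanSpace.single i 1) (EuclideanSpace.single j 1) =
      normalPart φ i j u + ∑ p, christoffel φ p i j u • partialOne φ p u := by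
    simp [normalPart, partialTwo]
  rw [h3, map_add, Submodule.starProjection_eq_self_iff.2 h1,
    (Submodule.starProjection_apply_eq_zero_iff _).2 h2, add_zero]

theorem secondFundamentalForm_eq_sum [FiniteDimensional ℝ E] (h : ContDiffAt ℝ ∞ φ u)
    (hi : Function.Injective (fderiv ℝ φ u)) (x y : EuclideanSpace ℝ (Fin n)) :
    secondFundamentalForm φ u x y = ∑ i, ∑ j, (x i * y j) • normalPart φ i j u := by
  simp only [← secondFundamentalForm_single h hi]
  unfold secondFundamentalForm
  conv_lhs => rw [euclidean_eq_sum_single x, euclidean_eq_sum_single y]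
  simp only [map_sum, map_smul, sum_apply, smul_apply, Finset.smul_sum, smul_smul]
  rw [Finset.sum_comm]
  exact Finset.sum_congr rfl fun i _ => Finset.sum_congr rfl fun j _ => by rw [mul_comm]

theorem inner_secondFundamentalForm [FiniteDimensional ℝ E] (h : ContDiffAt ℝ ∞ φ u)
    (hi : Function.Injective (fderiv ℝ φ u)) (x y z w : EuclideanSpace ℝ (Fin n)) :
    inner ℝ (secondFundamentalForm φ u x y) (secondFundamentalForm φ u z w) =
      ∑ i, ∑ j, ∑ k, ∑ q, x i * y j * (z k * w q) *
        inner ℝ (normalPart φ i j u) (normalPart φ k q u) := by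
  rw [secondFundamentalForm_eq_sum h hi, secondFundamentalForm_eq_sum h hi]
  rw [sum_inner]
  refine Finset.sum_congr rfl fun i _ => ?_
  rw [sum_inner]
  refine Finset.sum_congr rfl fun j _ => ?_
  rw [inner_sum]
  refine Finset.sum_congr rfl fun k _ => ?_
  rw [inner_sum]
  refine Finset.sum_congr rfl fun q _ => ?_
  rw [inner_smul_left, inner_smul_right, RCLike.conj_to_real]
  ring

theorem sum_sub_eq_sum_sub_sum (x y z w : Fin n → ℝ) (B : Fin n → Fin n → Fin n → Fin n → ℝ) :
    ∑ i, ∑ j, ∑ k, ∑ q, x i * y j * w k * z q * (B j k i q - B i k j q) =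
      ∑ j, ∑ k, ∑ i, ∑ q, y j * w k * (x i * z q) * B j k i q -
        ∑ i, ∑ k, ∑ j, ∑ q, x i * w k * (y j * z q) * B i k j q := by
  have h1 : ∑ j, ∑ k, ∑ i, ∑ q, y j * w k * (x i * z q) * B j k i q =
      ∑ i, ∑ j, ∑ k, ∑ q, y j * w k * (x i * z q) * B j k i q := by
    symm
    rw [Finset.sum_comm]
    exact Finset.sum_congr rfl fun j _ => Finset.sum_comm
  have h2 : ∑ i, ∑ k, ∑ j, ∑ q, x i * w k * (y j * z q) * B i k j q =
      ∑ i, ∑ j, ∑ k, ∑ q, x i * w k * (y j * z q) * B i k j q :=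
    Finset.sum_congr rfl fun i _ => Finset.sum_comm
  rw [h1, h2]
  simp only [← Finset.sum_sub_distrib]
  exact Finset.sum_congr rfl fun i _ => Finset.sum_congr rfl fun j _ =>
    Finset.sum_congr rfl fun k _ => Finset.sum_congr rfl fun q _ => by ring

theorem riemann_eq_sum (hU : IsOpen U) (hφ : ContDiffOn ℝ ∞ φ U)
    (hi : ∀ v ∈ U, Function.Injective (fderiv ℝ φ v)) (hu : u ∈ U)
    (x y z w : EuclideanSpace ℝ (Fin n)) :
    riemann φ u x y z w = ∑ i, ∑ j, ∑ k, ∑ q, x i * y j * w k * z q *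
      (inner ℝ (normalPart φ j k u) (normalPart φ i q u) -
        inner ℝ (normalPart φ i k u) (normalPart φ j q u)) := by
  unfold riemann
  refine Finset.sum_congr rfl fun i _ => Finset.sum_congr rfl fun j _ =>
    Finset.sum_congr rfl fun k _ => ?_
  rw [Finset.sum_comm]
  refine Finset.sum_congr rfl fun q _ => ?_
  rw [← sum_curvatureCoeff_mul_metricMatrix hU hφ hi hu, Finset.mul_sum]
  exact Finset.sum_congr rfl fun p _ => by ring

/-- The Gauss equation. -/
theorem riemann_eq [FiniteDimensional ℝ E] (hU : IsOpen U) (hφ : ContDiffOn ℝ ∞ φ U)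
    (hi : ∀ v ∈ U, Function.Injective (fderiv ℝ φ v)) (hu : u ∈ U)
    (x y z w : EuclideanSpace ℝ (Fin n)) :
    riemann φ u x y z w =
      inner ℝ (secondFundamentalForm φ u y w) (secondFundamentalForm φ u x z) -
        inner ℝ (secondFundamentalForm φ u x w) (secondFundamentalForm φ u y z) := by
  have hc := hφ.contDiffAt (hU.mem_nhds hu)
  rw [riemann_eq_sum hU hφ hi hu, inner_secondFundamentalForm hc (hi u hu),
    inner_secondFundamentalForm hc (hi u hu)]
  exact sum_sub_eq_sum_sub_sum x y z w
    fun i j k q => inner ℝ (normalPart φ i j u) (normalPart φ k q u)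

/-- If `F` has the frame as columns, orthonormality reads `Fᵀ g F = 1`. Since `F` is square, the
left inverse `Fᵀ` of `g F` is also a right inverse, so `F Fᵀ = g⁻¹`. -/
theorem sum_orthonormal_mul_eq_inv {κ : Type*} [Fintype κ] [DecidableEq κ]
    (hκ : Fintype.card κ = n) {f : κ → EuclideanSpace ℝ (Fin n)}
    (hf : ∀ a b, inducedMetric φ u (f a) (f b) = if a = b then 1 else 0) (p q : Fin n) :
    ∑ a, f a p * f a q = (metricMatrix φ u)⁻¹ p q := by
  set F : Matrix (Fin n) κ ℝ := Matrix.of fun i a => f a i with hF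
  have h1 : Fᵀ * (metricMatrix φ u * F) = 1 := by
    ext a b
    rw [Matrix.one_apply, ← hf a b, inducedMetric_eq_sum]
    simp only [Matrix.mul_apply, Matrix.transpose_apply, hF, Matrix.of_apply, Finset.mul_sum]
    exact Finset.sum_congr rfl fun i _ => Finset.sum_congr rfl fun j _ => by ring
  have h2 : metricMatrix φ u * F * Fᵀ = 1 :=
    (Matrix.mul_eq_one_comm_of_card_eq _ _ _ (by simp [hκ])).1 h1
  rw [Matrix.mul_assoc] at h2
  rw [Matrix.inv_eq_right_inv h2]
  rfl

/-- The Ricci tensor is the sum of sectional terms over an orthonormal frame. -/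
theorem ricci_eq_sum_riemann (hi : Function.Injective (fderiv ℝ φ u)) {κ : Type*} [Fintype κ]
    [DecidableEq κ] (hκ : Fintype.card κ = n) {f : κ → EuclideanSpace ℝ (Fin n)}
    (hf : ∀ a b, inducedMetric φ u (f a) (f b) = if a = b then 1 else 0)
    (y z : EuclideanSpace ℝ (Fin n)) :
    ricci φ u y z = ∑ a, riemann φ u (f a) y (f a) z := by
  have h1 : ∀ i p : Fin n, ∑ a, ∑ q, f a i * (f a q * metricMatrix φ u p q) =
      if i = p then 1 else 0 := by
    intro i p
    rw [Finset.sum_comm]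
    have : ∀ q, ∑ a, f a i * (f a q * metricMatrix φ u p q) =
        (metricMatrix φ u)⁻¹ i q * metricMatrix φ u q p := by
      intro q
      rw [← sum_orthonormal_mul_eq_inv hκ hf, Finset.sum_mul, metricMatrix_comm]
      exact Finset.sum_congr rfl fun a _ => by ring
    simp only [this]
    rw [← Matrix.mul_apply, Matrix.nonsing_inv_mul _ (isUnit_det_metricMatrix hi),
      Matrix.one_apply]
  have h2 : ∀ i j k p, ∑ a, ∑ q, f a i * y j * z k * f a q * curvatureCoeff φ p i j k u *
      metricMatrix φ u p q = y j * z k * curvatureCoeff φ p i j k u * if i = p then 1 else 0 := by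
    intro i j k p
    rw [← h1 i p, Finset.mul_sum]
    refine Finset.sum_congr rfl fun a _ => ?_
    rw [Finset.mul_sum]
    exact Finset.sum_congr rfl fun q _ => by ring
  have h3 : ∀ i j k, ∑ a, ∑ p, ∑ q, f a i * y j * z k * f a q * curvatureCoeff φ p i j k u *
      metricMatrix φ u p q = y j * z k * curvatureCoeff φ i i j k u := by
    intro i j k
    rw [Finset.sum_comm, Finset.sum_congr rfl fun p _ => h2 i j k p]
    simp
  unfold riemann ricci
  symm
  rw [Finset.sum_comm]
  refine Finset.sum_congr rfl fun i _ => ?_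
  rw [Finset.sum_comm]
  refine Finset.sum_congr rfl fun j _ => ?_
  rw [Finset.sum_comm]
  exact Finset.sum_congr rfl fun k _ => h3 i j k

end GaussEquation

/-! ### Algebra of anticommuting symmetric involutions. -/

section CliffordFamily

variable {E : Type*} [NormedAddCommGroup E] [InnerProductSpace ℝ E]

/-- A family of anticommuting symmetric involutions of a Euclidean space. -/
structure IsCliffordFamily {ι : Type*} (A : ι → E →ₗ[ℝ] E) : Prop where
  isSymmetric : ∀ i, (A i).IsSymmetric
  apply_apply : ∀ i x, A i (A i x) = x
  anticomm : ∀ i j, i ≠ j → ∀ x, A i (A j x) = -A j (A i x)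

/-- The unit vectors at which all the quadratic forms `⟨A_i x, x⟩` vanish. -/
def stiefel {ι : Type*} (A : ι → E →ₗ[ℝ] E) : Set E :=
  {x | ‖x‖ = 1 ∧ ∀ i, inner ℝ (A i x) x = 0}

/-- The family `A` together with the identity. -/
def adjoinId {ι : Type*} (A : ι → E →ₗ[ℝ] E) : Option ι → E →ₗ[ℝ] E
  | none => LinearMap.id
  | some i => A i

@[simp] theorem adjoinId_none {ι : Type*} (A : ι → E →ₗ[ℝ] E) :
    adjoinId A none = LinearMap.id := rfl

@[simp] theorem adjoinId_some {ι : Type*} (A : ι → E →ₗ[ℝ] E) (i : ι) :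
    adjoinId A (some i) = A i := rfl

namespace IsCliffordFamily

variable {ι : Type*} {A : ι → E →ₗ[ℝ] E}

theorem inner_apply_apply (hA : IsCliffordFamily A) (i : ι) (x y : E) :
    inner ℝ (A i x) (A i y) = inner ℝ x y := by
  rw [hA.isSymmetric, hA.apply_apply]

theorem norm_apply (hA : IsCliffordFamily A) (i : ι) (x : E) : ‖A i x‖ = ‖x‖ := by
  rw [← sq_eq_sq₀ (norm_nonneg _) (norm_nonneg _), ← real_inner_self_eq_norm_sq,
    ← real_inner_self_eq_norm_sq, hA.inner_apply_apply]

theorem inner_apply_of_ne (hA : IsCliffordFamily A) {i j : ι} (hij : i ≠ j) (x : E) :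
    inner ℝ (A i x) (A j x) = 0 := by
  have h1 : inner ℝ (A i x) (A j x) = inner ℝ (A j (A i x)) x := (hA.isSymmetric j _ _).symm
  have h2 : inner ℝ (A i x) (A j x) = -inner ℝ (A j (A i x)) x := by
    rw [hA.isSymmetric i, hA.anticomm i j hij, inner_neg_right, real_inner_comm]
  linarith

theorem isSymmetric_adjoinId (hA : IsCliffordFamily A) (a : Option ι) :
    (adjoinId A a).IsSymmetric := by
  cases a with
  | none => exact fun _ _ => rfl
  | some i => exact hA.isSymmetric i

theorem norm_adjoinId_apply (hA : IsCliffordFamily A) (a : Option ι) (x : E) :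
    ‖adjoinId A a x‖ = ‖x‖ := by
  cases a with
  | none => rfl
  | some i => exact hA.norm_apply i x

theorem orthonormal_adjoinId (hA : IsCliffordFamily A) {x : E} (hx : x ∈ stiefel A) :
    Orthonormal ℝ fun a => adjoinId A a x := by
  refine ⟨fun a => (hA.norm_adjoinId_apply a x).trans hx.1, ?_⟩
  rintro (_ | i) (_ | j) hab
  · exact absurd rfl hab
  · simpa [real_inner_comm] using hx.2 j
  · exact hx.2 i
  · exact hA.inner_apply_of_ne (fun h => hab (by rw [h])) x

/-- The normal vectors `x, A_j x` add nothing to the trace of `A_i`, so that trace is carried by the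
tangent space alone. -/
theorem inner_apply_adjoinId (hA : IsCliffordFamily A) {x : E} (hx : x ∈ stiefel A) (i : ι)
    (a : Option ι) : inner ℝ (adjoinId A a x) (A i (adjoinId A a x)) = 0 := by
  cases a with
  | none => rw [real_inner_comm]; exact hx.2 i
  | some j =>
    by_cases hij : i = j
    · subst hij
      simpa [hA.apply_apply] using hx.2 i
    · rw [adjoinId_some, hA.anticomm i j hij, inner_neg_right, hA.inner_apply_apply,
        real_inner_comm, hx.2 i, neg_zero]

/-- Conjugation by another member `A_j` turns `A_i` into `-A_i`; this is why at least two members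
are required. -/
theorem trace_eq_zero [Nontrivial ι] (hA : IsCliffordFamily A) (i : ι) :
    LinearMap.trace ℝ E (A i) = 0 := by
  obtain ⟨j, hj⟩ := exists_ne i
  have h1 : A i * A j * A j = A i := by
    ext x; simp [hA.apply_apply]
  have h2 : A j * (A i * A j) = -A i := by
    ext x; simp [hA.anticomm i j hj.symm, hA.apply_apply]
  have h3 := LinearMap.trace_mul_comm ℝ (A i * A j) (A j)
  rw [h1, h2, map_neg] at h3
  linarith

end IsCliffordFamily

end CliffordFamily

/-! ### Normal frame and second fundamental form of the Clifford-Stiefel variety. -/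

section Stiefel

variable {n : ℕ} {E : Type*} [NormedAddCommGroup E] [InnerProductSpace ℝ E]
  {ι : Type*} {A : ι → E →ₗ[ℝ] E}
  {φ : EuclideanSpace ℝ (Fin n) → E} {U : Set (EuclideanSpace ℝ (Fin n))}
  {u : EuclideanSpace ℝ (Fin n)}

theorem IsLocalParametrization.apply_mem {M : Set E} (h : IsLocalParametrization M U φ)
    (hu : u ∈ U) : φ u ∈ M := by
  obtain ⟨W, -, hW⟩ := h.isOpenMap U subset_rfl h.isOpen
  exact (hW.le (Set.mem_image_of_mem φ hu)).1

theorem IsLocalParametrization.contDiffAt {M : Set E} (h : IsLocalParametrization M U φ)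
    (hu : u ∈ U) : ContDiffAt ℝ ∞ φ u :=
  h.contDiffOn.contDiffAt (h.isOpen.mem_nhds hu)

theorem inner_adjoinId_self {x : E} (hx : x ∈ stiefel A) (a : Option ι) :
    inner ℝ (adjoinId A a x) x = if a = none then 1 else 0 := by
  cases a with
  | none => simp [hx.1]
  | some i => simpa using hx.2 i

variable [FiniteDimensional ℝ E]

/-- The function `⟨A_a φ, φ⟩` is constant on `U`; its derivative is twice this inner product because
`A_a` is symmetric. -/
theorem inner_adjoinId_fderiv (hA : IsCliffordFamily A)
    (h : IsLocalParametrization (stiefel A) U φ) (hu : u ∈ U) (a : Option ι)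
    (y : EuclideanSpace ℝ (Fin n)) :
    inner ℝ (adjoinId A a (φ u)) (fderiv ℝ φ u y) = 0 := by
  set B : E →L[ℝ] E := LinearMap.toContinuousLinearMap (adjoinId A a) with hB
  have hd : HasFDerivAt φ (fderiv ℝ φ u) u :=
    ((h.contDiffAt hu).differentiableAt (by simp)).hasFDerivAt
  have h1 := (B.hasFDerivAt.comp u hd).inner ℝ hd
  have h2 : (fun v => inner ℝ (B (φ v)) (φ v)) =ᶠ[nhds u]
      fun _ => if a = none then (1 : ℝ) else 0 := by
    filter_upwards [h.isOpen.mem_nhds hu] with v hv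
    exact inner_adjoinId_self (h.apply_mem hv) a
  have h3 := congrArg (fun L => L y) (h1.unique (h2.hasFDerivAt_iff.2 (hasFDerivAt_const _ _)))
  have h4 : inner ℝ (B (φ u)) (fderiv ℝ φ u y) + inner ℝ (B (fderiv ℝ φ u y)) (φ u) = 0 := by
    simpa [fderivInnerCLM_apply] using h3
  have h5 : inner ℝ (B (fderiv ℝ φ u y)) (φ u) = inner ℝ (B (φ u)) (fderiv ℝ φ u y) := by
    rw [real_inner_comm]
    exact (hA.isSymmetric_adjoinId a _ _).symm
  change inner ℝ (B (φ u)) (fderiv ℝ φ u y) = 0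
  linarith

/-- A second differentiation of the constraint: it trades the normal components of `D²φ` for first
derivatives. -/
theorem inner_adjoinId_fderiv_fderiv (hA : IsCliffordFamily A)
    (h : IsLocalParametrization (stiefel A) U φ) (hu : u ∈ U) (a : Option ι)
    (x y : EuclideanSpace ℝ (Fin n)) :
    inner ℝ (adjoinId A a (φ u)) (fderiv ℝ (fderiv ℝ φ) u x y) =
      -inner ℝ (adjoinId A a (fderiv ℝ φ u x)) (fderiv ℝ φ u y) := by
  set B : E →L[ℝ] E := LinearMap.toContinuousLinearMap (adjoinId A a) with hB
  have hd : HasFDerivAt φ (fderiv ℝ φ u) u :=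
    ((h.contDiffAt hu).differentiableAt (by simp)).hasFDerivAt
  have hd2 : HasFDerivAt (fderiv ℝ φ) (fderiv ℝ (fderiv ℝ φ) u) u :=
    ((contDiffAt_fderiv (h.contDiffAt hu)).differentiableAt (by simp)).hasFDerivAt
  have h1 := (B.hasFDerivAt.comp u hd).inner ℝ (hd2.clm_apply (hasFDerivAt_const y u))
  have h2 : (fun v => inner ℝ (B (φ v)) (fderiv ℝ φ v y)) =ᶠ[nhds u] fun _ => (0 : ℝ) := by
    filter_upwards [h.isOpen.mem_nhds hu] with v hv
    exact inner_adjoinId_fderiv hA h hv a y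
  have h3 := congrArg (fun L => L x) (h1.unique (h2.hasFDerivAt_iff.2 (hasFDerivAt_const _ _)))
  have h4 : inner ℝ (B (φ u)) (fderiv ℝ (fderiv ℝ φ) u x y) +
      inner ℝ (B (fderiv ℝ φ u x)) (fderiv ℝ φ u y) = 0 := by
    simpa [fderivInnerCLM_apply] using h3
  change inner ℝ (B (φ u)) _ = -inner ℝ (B _) _
  linarith

/-- An adapted frame: an orthonormal frame of the tangent space followed by the normal frame
`x, A_i x`. -/
theorem orthonormal_sumElim_adjoinId (hA : IsCliffordFamily A)
    (h : IsLocalParametrization (stiefel A) U φ) (hu : u ∈ U) {κ : Type*} [DecidableEq κ]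
    {f : κ → EuclideanSpace ℝ (Fin n)}
    (hf : ∀ a b, inducedMetric φ u (f a) (f b) = if a = b then 1 else 0) :
    Orthonormal ℝ (Sum.elim (fun c => fderiv ℝ φ u (f c)) fun a => adjoinId A a (φ u)) := by
  have h1 := hA.orthonormal_adjoinId (h.apply_mem hu)
  constructor
  · rintro (c | a)
    · have := hf c c
      rw [if_pos rfl, inducedMetric, real_inner_self_eq_norm_sq] at this
      exact (pow_eq_one_iff_of_nonneg (norm_nonneg _) two_ne_zero).1 this
    · exact h1.1 a
  · rintro (c | a) (d | b) hab
    · exact (hf c d).trans (if_neg fun h => hab (by rw [h]))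
    · rw [real_inner_comm]
      exact inner_adjoinId_fderiv hA h hu b (f c)
    · exact inner_adjoinId_fderiv hA h hu a (f d)
    · exact h1.2 fun h => hab (by rw [h])

variable [Fintype ι]

theorem exists_adapted_basis (hA : IsCliffordFamily A)
    (h : IsLocalParametrization (stiefel A) U φ) (hu : u ∈ U) {κ : Type*} [Fintype κ]
    [DecidableEq κ] (hκ : Fintype.card κ = n)
    (hn : n + (Fintype.card ι + 1) = Module.finrank ℝ E)
    {f : κ → EuclideanSpace ℝ (Fin n)}
    (hf : ∀ a b, inducedMetric φ u (f a) (f b) = if a = b then 1 else 0) :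
    ∃ b : OrthonormalBasis (κ ⊕ Option ι) ℝ E,
      (∀ c, b (Sum.inl c) = fderiv ℝ φ u (f c)) ∧
        ∀ a, b (Sum.inr a) = adjoinId A a (φ u) := by
  have h1 := orthonormal_sumElim_adjoinId hA h hu hf
  have h2 := h1.linearIndependent.span_eq_top_of_card_eq_finrank'
    (by simp [hκ, ← hn])
  refine ⟨OrthonormalBasis.mk h1 h2.ge, fun c => ?_, fun a => ?_⟩ <;> simp

/-- The second fundamental form of the Clifford-Stiefel variety. -/
theorem secondFundamentalForm_stiefel (hA : IsCliffordFamily A)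
    (h : IsLocalParametrization (stiefel A) U φ) (hu : u ∈ U) {κ : Type*} [Fintype κ]
    [DecidableEq κ] (hκ : Fintype.card κ = n)
    (hn : n + (Fintype.card ι + 1) = Module.finrank ℝ E)
    {f : κ → EuclideanSpace ℝ (Fin n)}
    (hf : ∀ a b, inducedMetric φ u (f a) (f b) = if a = b then 1 else 0)
    (x y : EuclideanSpace ℝ (Fin n)) :
    secondFundamentalForm φ u x y =
      ∑ a, (-inner ℝ (adjoinId A a (fderiv ℝ φ u x)) (fderiv ℝ φ u y)) •
        adjoinId A a (φ u) := by
  obtain ⟨b, hb1, hb2⟩ := exists_adapted_basis hA h hu hκ hn hf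
  unfold secondFundamentalForm
  have h1 := b.sum_repr' (fderiv ℝ (fderiv ℝ φ) u x y)
  rw [Fintype.sum_sum_type] at h1
  simp only [hb1, hb2, inner_adjoinId_fderiv_fderiv hA h hu] at h1
  rw [← h1, map_add, (Submodule.starProjection_apply_eq_zero_iff _).2, zero_add,
    Submodule.starProjection_eq_self_iff.2]
  · refine Submodule.sum_mem _ fun p _ => Submodule.smul_mem _ _ ?_
    rw [Submodule.mem_orthogonal']
    rintro _ ⟨z, rfl⟩
    exact inner_adjoinId_fderiv hA h hu p z
  · apply Submodule.le_orthogonal_orthogonal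
    exact Submodule.sum_mem _ fun p _ => Submodule.smul_mem _ _ ⟨_, rfl⟩

theorem inner_secondFundamentalForm_stiefel (hA : IsCliffordFamily A)
    (h : IsLocalParametrization (stiefel A) U φ) (hu : u ∈ U) {κ : Type*} [Fintype κ]
    [DecidableEq κ] (hκ : Fintype.card κ = n)
    (hn : n + (Fintype.card ι + 1) = Module.finrank ℝ E)
    {f : κ → EuclideanSpace ℝ (Fin n)}
    (hf : ∀ a b, inducedMetric φ u (f a) (f b) = if a = b then 1 else 0)
    (x y z w : EuclideanSpace ℝ (Fin n)) :
    inner ℝ (secondFundamentalForm φ u x y) (secondFundamentalForm φ u z w) =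
      ∑ a, inner ℝ (adjoinId A a (fderiv ℝ φ u x)) (fderiv ℝ φ u y) *
        inner ℝ (adjoinId A a (fderiv ℝ φ u z)) (fderiv ℝ φ u w) := by
  rw [secondFundamentalForm_stiefel hA h hu hκ hn hf,
    secondFundamentalForm_stiefel hA h hu hκ hn hf,
    (hA.orthonormal_adjoinId (h.apply_mem hu)).inner_sum]
  simp

end Stiefel

/-! ### The estimate of `ACS`. -/

section ACS

variable {n : ℕ} {E : Type*} [NormedAddCommGroup E] [InnerProductSpace ℝ E] {φ : EuclideanSpace ℝ (Fin n) → E} {U : Set (EuclideanSpace ℝ (Fin n))}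
  {u : EuclideanSpace ℝ (Fin n)}

/-- A frame of `N^⊥` extended by `N`. -/
def extendFrame (N : EuclideanSpace ℝ (Fin n)) (e : Fin (n - 1) → EuclideanSpace ℝ (Fin n)) :
    Option (Fin (n - 1)) → EuclideanSpace ℝ (Fin n)
  | none => N
  | some k => e k

theorem inducedMetric_comm (x y : EuclideanSpace ℝ (Fin n)) :
    inducedMetric φ u x y = inducedMetric φ u y x :=
  real_inner_comm _ _

theorem inducedMetric_extendFrame {N : EuclideanSpace ℝ (Fin n)}
    {e : Fin (n - 1) → EuclideanSpace ℝ (Fin n)} (hN : inducedMetric φ u N N = 1)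
    (he : IsOrthonormalBasisOfPerp φ u N e) (a b : Option (Fin (n - 1))) :
    inducedMetric φ u (extendFrame N e a) (extendFrame N e b) = if a = b then 1 else 0 := by
  rcases a with _ | a <;> rcases b with _ | b
  · simpa [extendFrame] using hN
  · simpa [extendFrame, inducedMetric_comm N] using he.2 b
  · simpa [extendFrame] using he.2 a
  · simpa [extendFrame] using he.1 a b

variable [FiniteDimensional ℝ E]

theorem secondFundamentalForm_comm (hc : ContDiffAt ℝ ∞ φ u) (x y : EuclideanSpace ℝ (Fin n)) :
    secondFundamentalForm φ u x y = secondFundamentalForm φ u y x := by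
  unfold secondFundamentalForm
  rw [hc.isSymmSndFDerivAt (by simpa using ENat.LEInfty.out) x y]

/-- The Ricci term is expanded over `N, e_1, …, e_{n-1}`, where the `N`-term vanishes. The mixed
terms of the Gauss equation double the squares already present in `ACS`. -/
theorem acs_eq_sum (hn : 1 ≤ n) (hU : IsOpen U) (hφ : ContDiffOn ℝ ∞ φ U)
    (hi : ∀ v ∈ U, Function.Injective (fderiv ℝ φ v)) (hu : u ∈ U)
    {X N : EuclideanSpace ℝ (Fin n)} (hN : inducedMetric φ u N N = 1)
    {e : Fin (n - 1) → EuclideanSpace ℝ (Fin n)} (he : IsOrthonormalBasisOfPerp φ u N e) :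
    acs φ u X N e = ∑ k,
      (2 * inner ℝ (secondFundamentalForm φ u (e k) X) (secondFundamentalForm φ u (e k) X) +
        2 * inner ℝ (secondFundamentalForm φ u (e k) N) (secondFundamentalForm φ u (e k) N) -
        inner ℝ (secondFundamentalForm φ u (e k) (e k)) (secondFundamentalForm φ u X X) -
        inner ℝ (secondFundamentalForm φ u (e k) (e k)) (secondFundamentalForm φ u N N)) := by
  have hc := hφ.contDiffAt (hU.mem_nhds hu)
  have hr := riemann_eq hU hφ hi hu
  unfold acs
  rw [ricci_eq_sum_riemann (hi u hu) (by simp; omega) (inducedMetric_extendFrame hN he),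
    Fintype.sum_option]
  simp only [extendFrame, hr, sub_self, zero_add]
  rw [← Finset.sum_sub_distrib, ← Finset.sum_sub_distrib]
  refine Finset.sum_congr rfl fun k _ => ?_
  rw [secondFundamentalForm_comm hc X (e k), secondFundamentalForm_comm hc N (e k),
    ← real_inner_self_eq_norm_sq, ← real_inner_self_eq_norm_sq,
    real_inner_comm (secondFundamentalForm φ u (e k) (e k)) (secondFundamentalForm φ u X X),
    real_inner_comm (secondFundamentalForm φ u (e k) (e k)) (secondFundamentalForm φ u N N)]
  ring

variable {ι : Type*} [Fintype ι] {A : ι → E →ₗ[ℝ] E}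

/-- The Clifford-Stiefel variety has `ACS < 0` when its dimension is large. -/
theorem acsNegative_stiefel [Nontrivial ι] (hA : IsCliffordFamily A) (hn1 : 1 ≤ n)
    (hn : n + (Fintype.card ι + 1) = Module.finrank ℝ E)
    (hlarge : 16 + 17 * Fintype.card ι < 8 * n) : ACSNegative n (stiefel A) := by
  intro U φ h u hu X N hX hN hXN e he
  have hf := inducedMetric_extendFrame hN he
  have hκ : Fintype.card (Option (Fin (n - 1))) = n := by simp; omega
  obtain ⟨b, hb1, hb2⟩ := exists_adapted_basis hA h hu hκ hn hf
  rw [acs_eq_sum hn1 h.isOpen h.contDiffOn h.immersion hu hN he]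
  simp only [inner_secondFundamentalForm_stiefel hA h hu hκ hn hf, Finset.mul_sum,
    ← Finset.sum_add_distrib, ← Finset.sum_sub_distrib]
  rw [Finset.sum_comm]
  have bN : b (Sum.inl none) = fderiv ℝ φ u N := hb1 none
  have be : ∀ k, b (Sum.inl (some k)) = fderiv ℝ φ u (e k) := fun k => hb1 (some k)
  set ξ := fderiv ℝ φ u X with hξ
  set η := fderiv ℝ φ u N with hη
  set y := fun k => fderiv ℝ φ u (e k) with hy
  have nξ : ‖ξ‖ = 1 := by
    rw [inducedMetric, real_inner_self_eq_norm_sq] at hX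
    exact (pow_eq_one_iff_of_nonneg (norm_nonneg _) two_ne_zero).1 hX
  have nη : ‖η‖ = 1 := by rw [← bN]; exact b.norm_eq_one _
  -- Parseval for `A_a z` in the adapted basis, with the normal components discarded.
  have parseval : ∀ (a : Option ι) (z : E), ‖z‖ = 1 →
      ∑ k, inner ℝ (adjoinId A a (y k)) z ^ 2 + inner ℝ (adjoinId A a η) z ^ 2 ≤ 1 := by
    intro a z hz
    have h1 := b.sum_sq_norm_inner_right (adjoinId A a z)
    rw [hA.norm_adjoinId_apply, hz, Fintype.sum_sum_type, Fintype.sum_option] at h1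
    have h2 : 0 ≤ ∑ c, ‖inner ℝ (b (Sum.inr c)) (adjoinId A a z)‖ ^ 2 :=
      Finset.sum_nonneg fun _ _ => sq_nonneg _
    simp only [be, bN, Real.norm_eq_abs, sq_abs] at h1
    simp only [hA.isSymmetric_adjoinId a _ z, hy]
    simp only [Real.norm_eq_abs, sq_abs] at h2
    linarith
  have trace : ∀ i, ∑ k, inner ℝ (A i (y k)) (y k) = -inner ℝ (A i η) η := by
    intro i
    have h1 := LinearMap.trace_eq_sum_inner (A i) b
    rw [hA.trace_eq_zero, Fintype.sum_sum_type, Fintype.sum_option] at h1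
    simp only [be, bN, hb2, hA.inner_apply_adjoinId (h.apply_mem hu), Finset.sum_const_zero] at h1
    simp only [fun z => hA.isSymmetric i z z, hy]
    linarith
  have bound : ∀ (i : ι) (z : E), ‖z‖ = 1 → |inner ℝ (A i z) z| ≤ 1 := by
    intro i z hz
    have := abs_real_inner_le_norm (A i z) z
    rwa [hA.norm_apply, hz, one_mul] at this
  rw [Fintype.sum_option]
  -- With `s = ⟨A_i ξ, ξ⟩` and `t = ⟨A_i η, η⟩`, the sum is at most `2 + 2(1 - t²) + t(s + t) = 4 +
  -- s²/4 - (t - s/2)²`, and `s² ≤ 1`.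
  have hsome : ∀ i, ∑ k, (2 * (inner ℝ (A i (y k)) ξ * inner ℝ (A i (y k)) ξ) +
      2 * (inner ℝ (A i (y k)) η * inner ℝ (A i (y k)) η) -
      inner ℝ (A i (y k)) (y k) * inner ℝ (A i ξ) ξ -
      inner ℝ (A i (y k)) (y k) * inner ℝ (A i η) η) ≤ (17 / 4 : ℝ) := by
    intro i
    simp only [Finset.sum_add_distrib, Finset.sum_sub_distrib, ← Finset.mul_sum,
      ← Finset.sum_mul, trace, ← sq]
    have h1 := parseval (some i) ξ nξ
    have h2 := parseval (some i) η nη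
    simp only [adjoinId_some] at h1 h2
    have h3 := bound i ξ nξ
    have h4 : inner ℝ (A i ξ) ξ ^ 2 ≤ 1 := (sq_le_one_iff_abs_le_one _).2 h3
    nlinarith [sq_nonneg (inner ℝ (A i η) ξ), sq_nonneg (inner ℝ (A i η) η - inner ℝ (A i ξ) ξ / 2)]
  -- Here `η` is itself a unit vector orthogonal to every `y k`, so the squares contribute at most
  -- `2`, while the last two terms contribute `-2(n - 1)`.
  have hnone : ∑ k, (2 * (inner ℝ (y k) ξ * inner ℝ (y k) ξ) +
      2 * (inner ℝ (y k) η * inner ℝ (y k) η) -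
      inner ℝ (y k) (y k) * inner ℝ ξ ξ - inner ℝ (y k) (y k) * inner ℝ η η) ≤ 4 - 2 * (n : ℝ) := by
    have h0 : ∀ k, inner ℝ (y k) (y k) = (1 : ℝ) := fun k => by
      simpa [inducedMetric] using he.1 k k
    have h1 := parseval none ξ nξ
    have h2 := parseval none η nη
    simp only [adjoinId_none, LinearMap.id_apply] at h1 h2
    simp only [Finset.sum_add_distrib, Finset.sum_sub_distrib, ← Finset.mul_sum,
      ← sq, h0, real_inner_self_eq_norm_sq, nξ, nη] at h1 h2 ⊢
    simp only [Finset.sum_const, Finset.card_univ, Fintype.card_fin, nsmul_eq_mul]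
    rw [Nat.cast_sub hn1]
    push_cast
    nlinarith [sq_nonneg (inner ℝ η ξ)]
  have hsum := Finset.sum_le_sum fun i (_ : i ∈ Finset.univ) => hsome i
  rw [Finset.sum_const, Finset.card_univ, nsmul_eq_mul] at hsum
  have hl : (16 : ℝ) + 17 * Fintype.card ι < 8 * n := by exact_mod_cast hlarge
  calc _ ≤ 4 - 2 * (n : ℝ) + Fintype.card ι * (17 / 4) := add_le_add hnone hsum
    _ < 0 := by linarith

end ACS

/-! ### Eigenspaces of involutions. -/

section FixedSpace

variable {V : Type*} [AddCommGroup V] [Module ℝ V]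

/-- The fixed vectors of an endomorphism. -/
def fixedSpace (T : V →ₗ[ℝ] V) : Submodule ℝ V := LinearMap.ker (T - LinearMap.id)

theorem mem_fixedSpace {T : V →ₗ[ℝ] V} {x : V} : x ∈ fixedSpace T ↔ T x = x := by
  simp [fixedSpace, sub_eq_zero]

/-- Lets rank-nullity for `T - id` add up the dimensions of the two eigenspaces of `T`. -/
theorem range_sub_id_eq_fixedSpace_neg {T : V →ₗ[ℝ] V} (hT : ∀ x, T (T x) = x) :
    LinearMap.range (T - LinearMap.id) = fixedSpace (-T) := by
  ext y
  rw [mem_fixedSpace]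
  constructor
  · rintro ⟨x, rfl⟩
    simp [hT]
  · intro hy
    have hy' : T y = -y := neg_eq_iff_eq_neg.1 hy
    refine ⟨-(1 / 2 : ℝ) • y, ?_⟩
    simp only [LinearMap.sub_apply, map_smul, LinearMap.id_apply, hy']
    module

variable [FiniteDimensional ℝ V]

theorem finrank_fixedSpace_le_neg {T S : V →ₗ[ℝ] V} (hS : Function.Injective S)
    (hTS : ∀ x, T (S x) = -S (T x)) :
    Module.finrank ℝ (fixedSpace T) ≤ Module.finrank ℝ (fixedSpace (-T)) := by
  refine (LinearEquiv.finrank_eq (Submodule.equivMapOfInjective S hS (fixedSpace T))).le.trans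
    (Submodule.finrank_mono ?_)
  rintro _ ⟨x, hx, rfl⟩
  rw [SetLike.mem_coe, mem_fixedSpace] at hx
  simp [mem_fixedSpace, hTS, hx]

/-- The fixed space of an involution which anticommutes with an injective map has half the
dimension. -/
theorem two_mul_finrank_fixedSpace {T S : V →ₗ[ℝ] V} (hT : ∀ x, T (T x) = x)
    (hS : Function.Injective S) (hTS : ∀ x, T (S x) = -S (T x)) :
    2 * Module.finrank ℝ (fixedSpace T) = Module.finrank ℝ V := by
  have h1 := finrank_fixedSpace_le_neg hS hTS
  have h2 := finrank_fixedSpace_le_neg (T := -T) hS (fun x => by simp [hTS])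
  have h3 := LinearMap.finrank_range_add_finrank_ker (T - LinearMap.id)
  rw [range_sub_id_eq_fixedSpace_neg hT] at h3
  rw [neg_neg] at h2
  change _ + Module.finrank ℝ (fixedSpace T) = _ at h3
  omega

end FixedSpace

/-! ### The Clifford-Stiefel variety is nonempty and smooth. -/

section Stiefel

variable {E : Type*} [NormedAddCommGroup E] [InnerProductSpace ℝ E]
  {ι : Type*} {A : ι → E →ₗ[ℝ] E}

theorem mem_stiefel_iff {x : E} : x ∈ stiefel A ↔
    ∀ a, inner ℝ (adjoinId A a x) x - (if a = none then (1 : ℝ) else 0) = 0 := by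
  constructor
  · intro hx a
    rw [inner_adjoinId_self hx, sub_self]
  · intro h
    refine ⟨?_, fun i => by simpa using h (some i)⟩
    have h1 := h none
    simp only [adjoinId_none, LinearMap.id_apply, if_true, real_inner_self_eq_norm_sq,
      sub_eq_zero] at h1
    exact (pow_eq_one_iff_of_nonneg (norm_nonneg _) two_ne_zero).1 h1

variable [FiniteDimensional ℝ E] [Fintype ι]

/-- The `±1`-eigenspaces of `A_i` have half the dimension. Take a unit `u` in the first and a unit
`v` in the second orthogonal to all `A_k u`, which the dimension count allows. In `⟨A_k(u+v), u+v⟩`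
the cross terms vanish; the diagonal terms cancel for `k = i`, and vanish for `k ≠ i` because `A_k`
exchanges the eigenspaces. -/
theorem stiefel_nonempty [Nontrivial ι] (hA : IsCliffordFamily A)
    (hE : 2 * (Fintype.card ι + 1) ≤ Module.finrank ℝ E) : (stiefel A).Nonempty := by
  obtain ⟨i, j, hij⟩ := exists_pair_ne ι
  have hi : ∀ k, Function.Injective (A k) := fun k => Function.LeftInverse.injective (hA.apply_apply k)
  have hanti : ∀ x, A i (A j x) = -A j (A i x) := hA.anticomm i j hij
  have h1 := two_mul_finrank_fixedSpace (hA.apply_apply i) (hi j) hanti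
  have h2 := two_mul_finrank_fixedSpace (T := -A i) (S := A j) (by simp [hA.apply_apply]) (hi j)
    (by simp [hanti])
  obtain ⟨u, hu, hu1⟩ : ∃ u ∈ fixedSpace (A i), ‖u‖ = 1 := by
    have : Nontrivial (fixedSpace (A i)) := (Module.finrank_pos_iff (R := ℝ)).1 (by omega)
    obtain ⟨u, hu⟩ := exists_norm_eq (fixedSpace (A i)) zero_le_one
    exact ⟨u, u.2, hu⟩
  set K : Submodule ℝ E := Submodule.span ℝ (Set.range fun k => A k u) with hK
  have hKc : Module.finrank ℝ K ≤ Fintype.card ι := finrank_range_le_card _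
  have h3 := K.finrank_add_finrank_orthogonal
  have h4 := Submodule.finrank_sup_add_finrank_inf_eq (fixedSpace (-A i)) Kᗮ
  have h5 := Submodule.finrank_le (fixedSpace (-A i) ⊔ Kᗮ)
  obtain ⟨v, hv, hv1⟩ : ∃ v ∈ fixedSpace (-A i) ⊓ Kᗮ, ‖v‖ = 1 := by
    have : Nontrivial ↥(fixedSpace (-A i) ⊓ Kᗮ) := (Module.finrank_pos_iff (R := ℝ)).1 (by omega)
    obtain ⟨v, hv⟩ := exists_norm_eq ↥(fixedSpace (-A i) ⊓ Kᗮ) zero_le_one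
    exact ⟨v, v.2, hv⟩
  have hui : A i u = u := mem_fixedSpace.1 hu
  have hvi : A i v = -v := neg_eq_iff_eq_neg.1 (mem_fixedSpace.1 hv.1)
  have huv : ∀ k, inner ℝ (A k u) v = 0 := fun k =>
    Submodule.inner_right_of_mem_orthogonal (K := K) (Submodule.subset_span (Set.mem_range_self k)) hv.2
  have hself : ∀ k w, k ≠ i → (A i w = w ∨ A i w = -w) → inner ℝ (A k w) w = 0 := by
    intro k w hk hw
    have h6 : inner ℝ (A k w) w = -inner ℝ (A k w) w := by
      conv_lhs => rw [← hA.inner_apply_apply i, hA.anticomm i k hk.symm]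
      rcases hw with hw | hw <;> simp [hw]
    linarith
  have huv0 : inner ℝ u v = 0 := by rw [← hui]; exact huv i
  have key : ∀ k, inner ℝ (A k (u + v)) (u + v) = 0 := by
    intro k
    have h7 : inner ℝ (A k v) u = 0 := by
      rw [hA.isSymmetric, real_inner_comm]; exact huv k
    rw [map_add, inner_add_left, inner_add_right, inner_add_right, huv, h7]
    by_cases hk : k = i
    · subst hk
      rw [hui, hvi, inner_neg_left, real_inner_self_eq_norm_sq, real_inner_self_eq_norm_sq, hu1,
        hv1]
      ring
    · rw [hself k u hk (Or.inl hui), hself k v hk (Or.inr hvi)]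
      ring
  have hne : u + v ≠ 0 := by
    intro h0
    have : inner ℝ (u + v) u = 0 := by rw [h0, inner_zero_left]
    rw [inner_add_left, real_inner_comm, real_inner_comm u v] at this
    simp [hu1, huv0] at this
  refine ⟨‖u + v‖⁻¹ • (u + v), ?_, fun k => ?_⟩
  · rw [norm_smul, norm_inv, norm_norm, inv_mul_cancel₀ (norm_ne_zero_iff.2 hne)]
  · rw [map_smul, inner_smul_left, inner_smul_right, key]
    simp

/-- The Clifford-Stiefel variety is a smooth submanifold. -/
theorem isSmoothSubmanifold_stiefel (hA : IsCliffordFamily A) {n : ℕ}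
    (hn : n + (Fintype.card ι + 1) = Module.finrank ℝ E) :
    IsSmoothSubmanifold n (stiefel A) := by
  intro p hp
  have horth := hA.orthonormal_adjoinId hp
  set K : Submodule ℝ E := Submodule.span ℝ (Set.range fun a => adjoinId A a p) with hK
  have hKc : Module.finrank ℝ K = Fintype.card ι + 1 := by
    rw [hK, finrank_span_eq_card horth.linearIndependent, Fintype.card_option]
  have hKo : Module.finrank ℝ Kᗮ = n := by
    have := K.finrank_add_finrank_orthogonal
    omega
  let b : OrthonormalBasis (Fin n) ℝ Kᗮ := (stdOrthonormalBasis ℝ Kᗮ).reindex (finCongr hKo)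
  let π : E →L[ℝ] EuclideanSpace ℝ (Fin n) :=
    (b.repr.toContinuousLinearEquiv : Kᗮ →L[ℝ] EuclideanSpace ℝ (Fin n)) ∘L Kᗮ.orthogonalProjectionOnto
  let B : Option ι → E →L[ℝ] E := fun a => LinearMap.toContinuousLinearMap (adjoinId A a)
  -- The defining equations are completed by the projection `π` to the tangent space at `p`. This
  -- makes `Ψ` a local diffeomorphism, and the slice over `0` parametrizes the variety with `π` as
  -- inverse chart.
  let Ψ : E → (Option ι → ℝ) × EuclideanSpace ℝ (Fin n) :=
    fun x => (fun a => inner ℝ (B a x) x - (if a = none then (1 : ℝ) else 0), π x)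
  have hΨ : ContDiff ℝ ∞ Ψ := by
    refine ContDiff.prodMk (contDiff_pi.2 fun a => ?_) π.contDiff
    exact ((B a).contDiff.inner ℝ contDiff_id).sub contDiff_const
  have hΨd : ∀ x v, fderiv ℝ Ψ x v = (fun a => 2 * inner ℝ (B a x) v, π v) := by
    intro x v
    have h1 : ∀ a, HasFDerivAt (fun x => inner ℝ (B a x) x - (if a = none then (1 : ℝ) else 0))
        ((fderivInnerCLM ℝ (B a x, x)).comp ((B a).prod (ContinuousLinearMap.id ℝ E))) x := fun a =>
      ((B a).hasFDerivAt.inner ℝ (hasFDerivAt_id x)).sub_const _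
    rw [((hasFDerivAt_pi.2 h1).prodMk π.hasFDerivAt).fderiv]
    ext a
    · simp only [ContinuousLinearMap.prod_apply, ContinuousLinearMap.pi_apply,
        ContinuousLinearMap.comp_apply, fderivInnerCLM_apply, ContinuousLinearMap.id_apply]
      have h2 : inner ℝ (B a v) x = inner ℝ (B a x) v := by
        rw [real_inner_comm]
        exact (hA.isSymmetric_adjoinId a x v).symm
      rw [h2]; ring
    · rfl
  have hinj : Function.Injective (fderiv ℝ Ψ p) := by
    rw [injective_iff_map_eq_zero]
    intro v hv
    rw [hΨd, Prod.mk_eq_zero] at hv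
    have h1 : v ∈ Kᗮ := by
      rw [hK, Submodule.mem_orthogonal]
      intro w hw
      induction hw using Submodule.span_induction with
      | mem w hw =>
        obtain ⟨a, rfl⟩ := hw
        have h1 : 2 * inner ℝ (adjoinId A a p) v = 0 := congrFun hv.1 a
        linarith
      | zero => simp
      | add x y _ _ hx hy => rw [inner_add_left, hx, hy, add_zero]
      | smul c x _ hx => rw [inner_smul_left, hx, mul_zero]
    have h2 : Kᗮ.orthogonalProjectionOnto v = 0 := by
      simpa [π] using hv.2
    have h3 := Submodule.orthogonalProjectionOnto_mem_subspace_eq_self (⟨v, h1⟩ : Kᗮ)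
    rw [h2] at h3
    exact (congrArg Subtype.val h3).symm
  have hdim : Module.finrank ℝ E =
      Module.finrank ℝ ((Option ι → ℝ) × EuclideanSpace ℝ (Fin n)) := by
    simp [← hn, add_comm]
  let L : E ≃L[ℝ] (Option ι → ℝ) × EuclideanSpace ℝ (Fin n) :=
    (LinearEquiv.ofInjectiveOfFinrankEq (fderiv ℝ Ψ p).toLinearMap hinj hdim).toContinuousLinearEquiv
  have hL : (L : E →L[ℝ] (Option ι → ℝ) × EuclideanSpace ℝ (Fin n)) = fderiv ℝ Ψ p := by
    ext1 x; rfl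
  have hΨp : HasFDerivAt Ψ (L : E →L[ℝ] (Option ι → ℝ) × EuclideanSpace ℝ (Fin n)) p := by
    rw [hL]; exact (hΨ.differentiable (by simp) p).hasFDerivAt
  let Φ₀ := hΨ.contDiffAt.toOpenPartialHomeomorph Ψ hΨp (by simp)
  -- Restricting to points where `dΨ` is invertible makes the local inverse smooth on its whole
  -- domain, not just at `Ψ p`.
  let V : Set E := fderiv ℝ Ψ ⁻¹'
    Set.range ((↑) : (E ≃L[ℝ] (Option ι → ℝ) × EuclideanSpace ℝ (Fin n)) → E →L[ℝ] _)
  have hV : IsOpen V := ContinuousLinearEquiv.isOpen.preimage (hΨ.continuous_fderiv (by simp))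
  let Φ := Φ₀.restrOpen V hV
  have hΦ : ∀ x, Φ x = Ψ x := fun x => rfl
  have hpΦ : p ∈ Φ.source := ⟨ContDiffAt.mem_toOpenPartialHomeomorph_source _ _ _, ⟨L, hL⟩⟩
  have hsymm : ∀ y ∈ Φ.target, ContDiffAt ℝ ∞ Φ.symm y := by
    intro y hy
    obtain ⟨L', hL'⟩ := (Φ.map_target hy).2
    refine Φ.contDiffAt_symm hy (f₀' := L') ?_ hΨ.contDiffAt
    rw [hL']
    exact (hΨ.differentiable (by simp) _).hasFDerivAt
  let U : Set (EuclideanSpace ℝ (Fin n)) := {u | ((0 : Option ι → ℝ), u) ∈ Φ.target}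
  let φ : EuclideanSpace ℝ (Fin n) → E := fun u => Φ.symm (0, u)
  have hU : IsOpen U := Φ.open_target.preimage (by fun_prop)
  have hΨφ : ∀ u ∈ U, Ψ (φ u) = (0, u) := fun u hu => Φ.right_inv hu
  have hπφ : ∀ u ∈ U, π (φ u) = u := fun u hu => congrArg Prod.snd (hΨφ u hu)
  have hφM : ∀ u ∈ U, φ u ∈ stiefel A := fun u hu =>
    mem_stiefel_iff.2 fun a => congrFun (congrArg Prod.fst (hΨφ u hu)) a
  have hΨM : ∀ x ∈ stiefel A, Ψ x = (0, π x) := fun x hx =>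
    Prod.ext (funext fun a => mem_stiefel_iff.1 hx a) rfl
  have hφπ : ∀ x ∈ stiefel A, x ∈ Φ.source → π x ∈ U ∧ φ (π x) = x := by
    intro x hx hxs
    have h1 := Φ.map_source hxs
    have h2 := Φ.left_inv hxs
    rw [hΦ, hΨM x hx] at h1 h2
    exact ⟨h1, h2⟩
  have hφ : ContDiffOn ℝ ∞ φ U := fun u hu =>
    ((hsymm _ hu).comp u (contDiffAt_const.prodMk contDiffAt_id)).contDiffWithinAt
  refine ⟨U, φ, ⟨hU, hφ, fun u hu => ?_, fun u hu v hv huv => ?_, fun O hO hOo => ?_⟩, ?_⟩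
  · have h1 : HasFDerivAt φ (fderiv ℝ φ u) u :=
      ((hφ.contDiffAt (hU.mem_nhds hu)).differentiableAt (by simp)).hasFDerivAt
    have h2 : (π ∘ φ) =ᶠ[nhds u] id := by
      filter_upwards [hU.mem_nhds hu] with v hv using hπφ v hv
    have h3 := (π.hasFDerivAt.comp u h1).unique (h2.hasFDerivAt_iff.2 (hasFDerivAt_id u))
    exact Function.LeftInverse.injective (g := π) fun x => congrArg (fun M => M x) h3
  · rw [← hπφ u hu, ← hπφ v hv, huv]
  · refine ⟨Φ.source ∩ π ⁻¹' O, Φ.open_source.inter (hOo.preimage π.continuous), ?_⟩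
    ext x
    constructor
    · rintro ⟨u, hu, rfl⟩
      refine ⟨hφM u (hO hu), Φ.map_target (hO hu), ?_⟩
      rw [Set.mem_preimage, hπφ u (hO hu)]
      exact hu
    · rintro ⟨hx, hxs, hxO⟩
      exact ⟨π x, hxO, (hφπ x hx hxs).2⟩
  · exact ⟨π p, (hφπ p hp hpΦ).1, (hφπ p hp hpΦ).2⟩

end Stiefel

/-! ### Dimensions of Clifford modules. -/

section Divisibility

/-- A family of anticommuting involutions of a vector space. -/
structure IsAnticommutingFamily {V : Type*} [AddCommGroup V] [Module ℝ V] {ι : Type*}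
    (P : ι → V →ₗ[ℝ] V) : Prop where
  apply_apply : ∀ i x, P i (P i x) = x
  anticomm : ∀ i j, i ≠ j → ∀ x, P i (P j x) = -P j (P i x)

variable {V : Type*} [AddCommGroup V] [Module ℝ V]

namespace IsAnticommutingFamily

variable {ι κ : Type*} {P : ι → V →ₗ[ℝ] V}

theorem comp (hP : IsAnticommutingFamily P) {f : κ → ι} (hf : Function.Injective f) :
    IsAnticommutingFamily fun k => P (f k) :=
  ⟨fun _ => hP.apply_apply _, fun _ _ h => hP.anticomm _ _ (hf.ne h)⟩

theorem injective (hP : IsAnticommutingFamily P) (i : ι) : Function.Injective (P i) :=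
  Function.LeftInverse.injective (hP.apply_apply i)

theorem anticomm_of_lt [LinearOrder ι] (hP : IsAnticommutingFamily P) (i j : ι) (h : j < i)
    (x : V) : P i (P j x) = -P j (P i x) :=
  hP.anticomm i j h.ne' x

end IsAnticommutingFamily

/-- A vector space with an action of a division algebra `D` has dimension divisible by `dim D`. -/
theorem finrank_dvd_finrank_of_algHom {D : Type*} [DivisionRing D] [Algebra ℝ D]
    (f : D →ₐ[ℝ] Module.End ℝ V) : Module.finrank ℝ D ∣ Module.finrank ℝ V := by
  let _ : Module D V := Module.compHom V (f : D →+* Module.End ℝ V)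
  have : IsScalarTower ℝ D V := by
    refine ⟨fun r d v => ?_⟩
    change f (r • d) v = r • f d v
    simp
  exact ⟨_, (Module.finrank_mul_finrank ℝ D V).symm⟩

theorem two_dvd_finrank {J : V →ₗ[ℝ] V} (hJ : ∀ x, J (J x) = -x) :
    2 ∣ Module.finrank ℝ V := by
  rw [← Complex.finrank_real_complex]
  exact finrank_dvd_finrank_of_algHom
    (Complex.lift ⟨(J : Module.End ℝ V), LinearMap.ext fun x => by simp [hJ]⟩)

theorem four_dvd_finrank {I J : V →ₗ[ℝ] V} (hI : ∀ x, I (I x) = -x) (hJ : ∀ x, J (J x) = -x)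
    (hIJ : ∀ x, J (I x) = -I (J x)) : 4 ∣ Module.finrank ℝ V := by
  rw [← Quaternion.finrank_eq_four (R := ℝ)]
  let b : QuaternionAlgebra.Basis (Module.End ℝ V) (-1 : ℝ) 0 (-1) :=
    { i := I
      j := J
      k := I * J
      i_mul_i := LinearMap.ext fun x => by simp [hI]
      j_mul_j := LinearMap.ext fun x => by simp [hJ]
      i_mul_j := rfl
      j_mul_i := LinearMap.ext fun x => by simp [hIJ] }
  exact finrank_dvd_finrank_of_algHom (D := Quaternion ℝ) b.liftHom

theorem map_mem_fixedSpace {T S : V →ₗ[ℝ] V} (h : ∀ x, T (S x) = S (T x)) {x : V}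
    (hx : x ∈ fixedSpace T) : S x ∈ fixedSpace T := by
  rw [mem_fixedSpace] at hx ⊢
  rw [h, hx]

variable [FiniteDimensional ℝ V]

theorem two_mul_finrank_inf_fixedSpace {W : Submodule ℝ V} {T S : V →ₗ[ℝ] V}
    (hTW : ∀ x ∈ W, T x ∈ W) (hSW : ∀ x ∈ W, S x ∈ W) (hT : ∀ x, T (T x) = x)
    (hS : Function.Injective S) (hTS : ∀ x, T (S x) = -S (T x)) :
    2 * Module.finrank ℝ ↥(W ⊓ fixedSpace T) = Module.finrank ℝ W := by
  have : W ⊓ fixedSpace T = Submodule.map W.subtype (fixedSpace (T.restrict hTW)) := by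
    ext x
    simp only [Submodule.mem_inf, mem_fixedSpace, Submodule.mem_map]
    constructor
    · rintro ⟨hx, hx'⟩
      exact ⟨⟨x, hx⟩, Subtype.ext hx', rfl⟩
    · rintro ⟨y, hy, rfl⟩
      exact ⟨y.2, congrArg Subtype.val hy⟩
  rw [this, ← two_mul_finrank_fixedSpace (T := T.restrict hTW) (S := S.restrict hSW)
    (fun x => Subtype.ext (hT x)) (fun x y hxy => Subtype.ext (hS (congrArg Subtype.val hxy)))
    (fun x => Subtype.ext (hTS x)),
    ← Submodule.finrank_map_subtype_eq W (fixedSpace (T.restrict hTW))]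

namespace IsAnticommutingFamily

theorem two_dvd {P : Fin 2 → V →ₗ[ℝ] V} (hP : IsAnticommutingFamily P) :
    2 ∣ Module.finrank ℝ V :=
  ⟨_, (two_mul_finrank_fixedSpace (hP.apply_apply 0) (hP.injective 1)
    (hP.anticomm 0 1 (by decide))).symm⟩

/-- `P 1 ∘ P 2` is a complex structure on the fixed space of `P 0`, which has half the dimension. -/
theorem four_dvd {P : Fin 3 → V →ₗ[ℝ] V} (hP : IsAnticommutingFamily P) :
    4 ∣ Module.finrank ℝ V := by
  have h1 := two_mul_finrank_fixedSpace (hP.apply_apply 0) (hP.injective 1)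
    (hP.anticomm 0 1 (by decide))
  have hs := hP.anticomm_of_lt
  have hq := hP.apply_apply
  have h2 : 2 ∣ Module.finrank ℝ (fixedSpace (P 0)) :=
    two_dvd_finrank (J := (P 1 ∘ₗ P 2).restrict fun x hx => map_mem_fixedSpace
      (fun y => by simp [hs 1 0, hs 2 0]) hx) fun x => Subtype.ext (by simp [hs 2 1, hq])
  omega

/-- `P 1 ∘ P 2` and `P 1 ∘ P 3` define a quaternionic structure on the fixed space of `P 0`. -/
theorem eight_dvd {P : Fin 4 → V →ₗ[ℝ] V} (hP : IsAnticommutingFamily P) :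
    8 ∣ Module.finrank ℝ V := by
  have h1 := two_mul_finrank_fixedSpace (hP.apply_apply 0) (hP.injective 1)
    (hP.anticomm 0 1 (by decide))
  have hs := hP.anticomm_of_lt
  have hq := hP.apply_apply
  have h2 : 4 ∣ Module.finrank ℝ (fixedSpace (P 0)) :=
    four_dvd_finrank
      (I := (P 1 ∘ₗ P 2).restrict fun x hx => map_mem_fixedSpace
        (fun y => by simp [hs 1 0, hs 2 0]) hx)
      (J := (P 1 ∘ₗ P 3).restrict fun x hx => map_mem_fixedSpace
        (fun y => by simp [hs 1 0, hs 3 0]) hx)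
      (fun x => Subtype.ext (by simp [hs 2 1, hq])) (fun x => Subtype.ext (by simp [hs 3 1, hq]))
      (fun x => Subtype.ext (by simp [hs 3 1, hs 3 2, hs 2 1, hq]))
  omega

/-- The volume element `T` of `P 1, …, P 4` is an involution commuting with `P 0`. Each of the two
halves the space, witnessed by `P 1` and then `P 5`, and the common fixed space is quaternionic. -/
theorem sixteen_dvd {P : Fin 6 → V →ₗ[ℝ] V} (hP : IsAnticommutingFamily P) :
    16 ∣ Module.finrank ℝ V := by
  have hs := hP.anticomm_of_lt
  have hq := hP.apply_apply
  set T : V →ₗ[ℝ] V := P 1 ∘ₗ P 2 ∘ₗ P 3 ∘ₗ P 4 with hT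
  have hTx : ∀ x, T x = P 1 (P 2 (P 3 (P 4 x))) := fun _ => rfl
  have h1 := two_mul_finrank_fixedSpace (T := T) (S := P 1) (by simp [hTx, hs, hq])
    (hP.injective 1) (by simp [hTx, hs, hq])
  have h2 := two_mul_finrank_inf_fixedSpace (W := fixedSpace T) (T := P 0) (S := P 5)
    (fun _ => map_mem_fixedSpace (by simp [hTx, hs]))
    (fun _ => map_mem_fixedSpace (by simp [hTx, hs]))
    (hq 0) (hP.injective 5) (hP.anticomm 0 5 (by decide))
  have hmem : ∀ S : V →ₗ[ℝ] V, (∀ x, T (S x) = S (T x)) → (∀ x, P 0 (S x) = S (P 0 x)) →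
      ∀ x ∈ fixedSpace T ⊓ fixedSpace (P 0), S x ∈ fixedSpace T ⊓ fixedSpace (P 0) :=
    fun S h h' x hx => ⟨map_mem_fixedSpace h hx.1, map_mem_fixedSpace h' hx.2⟩
  have h3 : 4 ∣ Module.finrank ℝ ↥(fixedSpace T ⊓ fixedSpace (P 0)) :=
    four_dvd_finrank
      (I := (P 1 ∘ₗ P 2).restrict (hmem _ (by simp [hTx, hs]) (by simp [hs])))
      (J := (P 1 ∘ₗ P 3).restrict (hmem _ (by simp [hTx, hs]) (by simp [hs])))
      (fun x => Subtype.ext (by simp [hs, hq])) (fun x => Subtype.ext (by simp [hs, hq]))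
      (fun x => Subtype.ext (by simp [hs, hq]))
  omega

/-- Bott periodicity: eight of the involutions cut out a subspace of a sixteenth of the dimension
which carries a family indexed by the others. -/
theorem exists_sixteen_mul_finrank_eq {κ : Type*} {P : Fin 8 ⊕ κ → V →ₗ[ℝ] V}
    (hP : IsAnticommutingFamily P) :
    ∃ (W : Submodule ℝ V) (R : κ → W →ₗ[ℝ] W), 16 * Module.finrank ℝ W = Module.finrank ℝ V ∧
      IsAnticommutingFamily R := by
  obtain ⟨Q, hQdef⟩ : ∃ Q : Fin 8 → V →ₗ[ℝ] V, Q = fun i => P (Sum.inl i) := ⟨_, rfl⟩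
  have hQ : IsAnticommutingFamily Q := hQdef ▸ hP.comp Sum.inl_injective
  obtain ⟨c, hcdef⟩ : ∃ c : κ → V →ₗ[ℝ] V, c = fun i => P (Sum.inr i) := ⟨_, rfl⟩
  have hc : IsAnticommutingFamily c := hcdef ▸ hP.comp Sum.inr_injective
  have hcQ : ∀ k i x, c k (Q i x) = -Q i (c k x) := fun k i => by
    subst hQdef hcdef; exact hP.anticomm _ _ (by simp)
  have hs := hQ.anticomm_of_lt
  have hq := hQ.apply_apply
  -- The index sets `1234`, `1256`, `1357` meet pairwise in two elements, so these involutions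
  -- commute with each other, and with `Q 0`. Since `4`, `6`, `7` each lie in just one of the sets,
  -- `Q 4`, `Q 6`, `Q 7` witness successive halvings.
  set T₁ : V →ₗ[ℝ] V := Q 1 ∘ₗ Q 2 ∘ₗ Q 3 ∘ₗ Q 4
  set T₂ : V →ₗ[ℝ] V := Q 1 ∘ₗ Q 2 ∘ₗ Q 5 ∘ₗ Q 6
  set T₃ : V →ₗ[ℝ] V := Q 1 ∘ₗ Q 3 ∘ₗ Q 5 ∘ₗ Q 7
  have hT₁ : ∀ x, T₁ x = Q 1 (Q 2 (Q 3 (Q 4 x))) := fun _ => rfl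
  have hT₂ : ∀ x, T₂ x = Q 1 (Q 2 (Q 5 (Q 6 x))) := fun _ => rfl
  have hT₃ : ∀ x, T₃ x = Q 1 (Q 3 (Q 5 (Q 7 x))) := fun _ => rfl
  clear_value T₁ T₂ T₃
  have h1 := two_mul_finrank_fixedSpace (T := T₁) (S := Q 4) (by simp [hT₁, hs, hq])
    (hQ.injective 4) (by simp [hT₁, hs, hq])
  have h2 := two_mul_finrank_inf_fixedSpace (W := fixedSpace T₁) (T := T₂) (S := Q 6)
    (fun _ => map_mem_fixedSpace (by simp [hT₁, hT₂, hs, hq]))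
    (fun _ => map_mem_fixedSpace (by simp [hT₁, hs]))
    (by simp [hT₂, hs, hq]) (hQ.injective 6) (by simp [hT₂, hs, hq])
  have h3 := two_mul_finrank_inf_fixedSpace (W := fixedSpace T₁ ⊓ fixedSpace T₂) (T := T₃)
    (S := Q 7)
    (fun _ hx => ⟨map_mem_fixedSpace (by simp [hT₁, hT₃, hs, hq]) hx.1,
      map_mem_fixedSpace (by simp [hT₂, hT₃, hs, hq]) hx.2⟩)
    (fun _ hx => ⟨map_mem_fixedSpace (by simp [hT₁, hs]) hx.1,
      map_mem_fixedSpace (by simp [hT₂, hs]) hx.2⟩)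
    (by simp [hT₃, hs, hq]) (hQ.injective 7) (by simp [hT₃, hs, hq])
  -- The set `235` meets each of the three index sets in two elements, so this product preserves the
  -- subspace; being odd and free of `Q 0`, it anticommutes with `Q 0`.
  have h4 := two_mul_finrank_inf_fixedSpace
    (W := fixedSpace T₁ ⊓ fixedSpace T₂ ⊓ fixedSpace T₃) (T := Q 0) (S := Q 2 ∘ₗ Q 3 ∘ₗ Q 5)
    (fun _ hx => ⟨⟨map_mem_fixedSpace (by simp [hT₁, hs]) hx.1.1,
      map_mem_fixedSpace (by simp [hT₂, hs]) hx.1.2⟩,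
      map_mem_fixedSpace (by simp [hT₃, hs]) hx.2⟩)
    (fun _ hx => ⟨⟨map_mem_fixedSpace (by simp [hT₁, hs, hq]) hx.1.1,
      map_mem_fixedSpace (by simp [hT₂, hs, hq]) hx.1.2⟩,
      map_mem_fixedSpace (by simp [hT₃, hs, hq]) hx.2⟩)
    (hq 0) ((hQ.injective 2).comp ((hQ.injective 3).comp (hQ.injective 5)))
    (by simp [hs])
  -- The volume element anticommutes with every `Q i` and commutes with every `c k`, so `c k ∘ θ`
  -- commutes with all `Q i` and therefore preserves the subspace.
  set θ : V →ₗ[ℝ] V := Q 0 ∘ₗ Q 1 ∘ₗ Q 2 ∘ₗ Q 3 ∘ₗ Q 4 ∘ₗ Q 5 ∘ₗ Q 6 ∘ₗ Q 7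
  have hθ : ∀ x, θ x = Q 0 (Q 1 (Q 2 (Q 3 (Q 4 (Q 5 (Q 6 (Q 7 x))))))) := fun _ => rfl
  clear_value θ
  have hθQ : ∀ i x, θ (Q i x) = -Q i (θ x) := by
    intro i x
    fin_cases i <;> simp [hθ, hs, hq]
  have hθθ : ∀ x, θ (θ x) = x := by
    intro x; simp [hθ, hs, hq]
  have hcθ : ∀ k x, c k (θ x) = θ (c k x) := by
    intro k x; simp [hθ, hcQ]
  have hmem : ∀ k, ∀ x ∈ fixedSpace T₁ ⊓ fixedSpace T₂ ⊓ fixedSpace T₃ ⊓ fixedSpace (Q 0),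
      (c k ∘ₗ θ) x ∈ fixedSpace T₁ ⊓ fixedSpace T₂ ⊓ fixedSpace T₃ ⊓ fixedSpace (Q 0) :=
    fun k x hx => ⟨⟨⟨map_mem_fixedSpace (by simp [hT₁, hθQ, hcQ]) hx.1.1.1,
      map_mem_fixedSpace (by simp [hT₂, hθQ, hcQ]) hx.1.1.2⟩,
      map_mem_fixedSpace (by simp [hT₃, hθQ, hcQ]) hx.1.2⟩,
      map_mem_fixedSpace (by simp [hθQ, hcQ]) hx.2⟩
  refine ⟨_, fun k => (c k ∘ₗ θ).restrict (hmem k), by omega, ?_, ?_⟩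
  · intro k x
    exact Subtype.ext (by simp [← hcθ, hθθ, hc.apply_apply])
  · intro j k hjk x
    exact Subtype.ext (by simp [← hcθ, hθθ, hc.anticomm j k hjk])

end IsAnticommutingFamily

/-- The dimension of a module over a Clifford algebra. -/
theorem IsAnticommutingFamily.two_mul_delta_dvd (m : ℕ) : ∀ {V : Type*} [AddCommGroup V]
    [Module ℝ V] [FiniteDimensional ℝ V] {P : Fin (m + 2) → V →ₗ[ℝ] V},
    IsAnticommutingFamily P → 2 * delta (m + 1) ∣ Module.finrank ℝ V := by
  induction m using Nat.strong_induction_on with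
  | _ m ih =>
    intro V _ _ _ P hP
    have hsub : ∀ (k : ℕ) (hk : k ≤ m + 2),
        IsAnticommutingFamily fun i : Fin k => P (Fin.castLE hk i) := fun k hk =>
      hP.comp (Fin.castLE_injective hk)
    -- Where `δ` does not increase, the surplus involutions are dropped.
    match m, ih, P, hP, hsub with
    | 0, _, P, hP, hsub => exact hP.two_dvd
    | 1, _, P, hP, hsub => exact hP.four_dvd
    | 2, _, P, hP, hsub => exact (hsub 4 (by norm_num)).eight_dvd
    | 3, _, P, hP, hsub => exact (hsub 4 (by norm_num)).eight_dvd
    | 4, _, P, hP, hsub => exact (hsub 6 (by norm_num)).sixteen_dvd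
    | 5, _, P, hP, hsub => exact (hsub 6 (by norm_num)).sixteen_dvd
    | 6, _, P, hP, hsub => exact (hsub 6 (by norm_num)).sixteen_dvd
    | 7, _, P, hP, hsub => exact (hsub 6 (by norm_num)).sixteen_dvd
    | r + 8, ih, P, hP, _ =>
      have e : Fin 8 ⊕ Fin (r + 2) ≃ Fin (r + 8 + 2) :=
        finSumFinEquiv.trans (finCongr (by omega))
      obtain ⟨W, R, hW, hR⟩ := (hP.comp e.injective).exists_sixteen_mul_finrank_eq
      have h1 := ih r (by omega) hR
      have h2 : delta (r + 8 + 1) = 16 * delta (r + 1) := rfl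
      rw [← hW, h2]
      obtain ⟨d, hd⟩ := h1
      exact ⟨d, by rw [hd]; ring⟩

/-- A step of `8` adds `56` on the left and multiplies the right by `16`. The inequality fails at
`9`, where it would read `77 < 64`; this is the origin of the offset. -/
theorem lt_four_mul_delta (r : ℕ) : 7 * (r + 10) + 14 < 4 * delta (r + 10) := by
  induction r using Nat.strong_induction_on with
  | _ r ih =>
    match r, ih with
    | 0, _ | 1, _ | 2, _ | 3, _ | 4, _ | 5, _ | 6, _ | 7, _ => norm_num [delta]
    | r + 8, ih =>
      have h1 := ih r (by omega)
      have h2 : delta (r + 8 + 10) = 16 * delta (r + 10) := rfl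
      omega

end Divisibility

/-! ### Finitely many Clifford systems of given size up to conjugation. -/

section Rigidity

open scoped MatrixOrder in
/-- A positive semidefinite real matrix has a symmetric square root which commutes with everything
that commutes with the matrix. -/
theorem exists_symm_sqrt {N : ℕ} {S : Matrix (Fin N) (Fin N) ℝ} (hS : S.PosSemidef) :
    ∃ R : Matrix (Fin N) (Fin N) ℝ, Rᵀ = R ∧ R * R = S ∧ ∀ B, Commute S B → Commute R B := by
  have h0 : 0 ≤ S := Matrix.nonneg_iff_posSemidef.2 hS
  have hsa : IsSelfAdjoint S := IsSelfAdjoint.of_nonneg h0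
  refine ⟨cfc Real.sqrt S, ?_, ?_, fun B hB => Commute.cfc_real hB _⟩
  · have h1 : IsSelfAdjoint (cfc Real.sqrt S) := cfc_predicate _ _
    simpa [IsSelfAdjoint, Matrix.star_eq_conjTranspose] using h1
  · rw [← cfc_mul Real.sqrt Real.sqrt S]
    conv_rhs => rw [← cfc_id ℝ S]
    exact cfc_congr fun x hx => Real.mul_self_sqrt (spectrum_nonneg_of_nonneg h0 hx)

/-- Two tuples of matrices are orthogonally conjugate. -/
def OrthogonallyConjugate {ι : Type*} {N : ℕ} (P Q : ι → Matrix (Fin N) (Fin N) ℝ) : Prop :=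
  ∃ U : Matrix (Fin N) (Fin N) ℝ, Uᵀ * U = 1 ∧ ∀ i, Q i * U = U * P i

/-- Similar tuples of symmetric matrices are orthogonally conjugate. -/
theorem orthogonallyConjugate_of_intertwiner {ι : Type*} {N : ℕ}
    {P Q : ι → Matrix (Fin N) (Fin N) ℝ} (hP : ∀ i, (P i).IsSymm) (hQ : ∀ i, (Q i).IsSymm)
    {A : Matrix (Fin N) (Fin N) ℝ} (hA : IsUnit A.det) (h : ∀ i, Q i * A = A * P i) :
    OrthogonallyConjugate P Q := by
  -- Polar decomposition: `R = (Aᵀ A)^{1/2}` commutes with every `P i`, so the orthogonal factor `A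
  -- R⁻¹` is still an intertwiner.
  have hS : (Aᵀ * A).PosSemidef := by
    simpa using Matrix.posSemidef_conjTranspose_mul_self A
  obtain ⟨R, hRt, hRR, hR⟩ := exists_symm_sqrt hS
  have hRdet : IsUnit R.det := by
    have h1 : R.det * R.det = A.det * A.det := by
      rw [← Matrix.det_mul, hRR, Matrix.det_mul, Matrix.det_transpose]
    exact isUnit_of_mul_isUnit_left (h1 ▸ hA.mul hA)
  have hcomm : ∀ i, R * P i = P i * R := by
    intro i
    refine hR (P i) ?_
    have h1 : P i * Aᵀ = Aᵀ * Q i := by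
      have := congrArg Matrix.transpose (h i)
      rw [Matrix.transpose_mul, Matrix.transpose_mul, (hP i).eq, (hQ i).eq] at this
      exact this.symm
    change Aᵀ * A * P i = P i * (Aᵀ * A)
    rw [Matrix.mul_assoc, ← h, ← Matrix.mul_assoc, ← h1, Matrix.mul_assoc]
  have hcomm' : ∀ i, R⁻¹ * P i = P i * R⁻¹ := by
    intro i
    calc R⁻¹ * P i = R⁻¹ * (P i * R) * R⁻¹ := by
          rw [Matrix.mul_assoc, Matrix.mul_nonsing_inv_cancel_right _ _ hRdet]
      _ = P i * R⁻¹ := by rw [← hcomm, Matrix.nonsing_inv_mul_cancel_left _ _ hRdet]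
  refine ⟨A * R⁻¹, ?_, fun i => ?_⟩
  · rw [Matrix.transpose_mul, Matrix.transpose_nonsing_inv, hRt, Matrix.mul_assoc,
      ← Matrix.mul_assoc Aᵀ, ← hRR, Matrix.mul_nonsing_inv_cancel_right _ _ hRdet,
      Matrix.nonsing_inv_mul _ hRdet]
  · rw [← Matrix.mul_assoc, h, Matrix.mul_assoc, ← hcomm', Matrix.mul_assoc]

variable {m l : ℕ}

/-- Averaging produces an intertwiner depending continuously on the Clifford system. -/
theorem exists_continuous_intertwiner
    {P : Fin (m + 1) → Matrix (Fin (2 * l)) (Fin (2 * l)) ℝ} (hP : IsCliffordSystem P)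
    (s : Finset (Fin (m + 1))) :
    ∃ A : (Fin (m + 1) → Matrix (Fin (2 * l)) (Fin (2 * l)) ℝ) →
        Matrix (Fin (2 * l)) (Fin (2 * l)) ℝ,
      Continuous A ∧ A P = 1 ∧ ∀ Q, IsCliffordSystem Q → ∀ j ∈ s, Q j * A Q * P j = A Q := by
  induction s using Finset.induction_on with
  | empty => exact ⟨fun _ => 1, continuous_const, rfl, by simp⟩
  | insert i s hi ih =>
    obtain ⟨A, hA, hA1, hAs⟩ := ih
    -- Averaging over the Clifford group, one generator at a time.
    refine ⟨fun Q => (1 / 2 : ℝ) • (A Q + Q i * A Q * P i), ?_, ?_, ?_⟩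
    · exact (hA.add (((continuous_apply i).matrix_mul hA).matrix_mul
        continuous_const)).const_smul (1 / 2 : ℝ)
    · simp only [hA1, Matrix.mul_one, hP.sq_eq_one]
      rw [← two_smul ℝ (1 : Matrix (Fin (2 * l)) (Fin (2 * l)) ℝ), smul_smul]
      norm_num
    · intro Q hQ j hj
      simp only [Matrix.mul_smul, Matrix.smul_mul, Matrix.mul_add, Matrix.add_mul]
      congr 1
      by_cases hji : j = i
      · subst hji
        have h1 : Q j * (Q j * A Q * P j) * P j = A Q := by
          calc Q j * (Q j * A Q * P j) * P j = (Q j * Q j) * A Q * (P j * P j) := by noncomm_ring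
            _ = A Q := by rw [hQ.sq_eq_one, hP.sq_eq_one, Matrix.one_mul, Matrix.mul_one]
        rw [h1, add_comm]
      -- The invariance already secured survives: moving `j` past `i` produces a sign on each side,
      -- and the two signs cancel.
      · have hjs : j ∈ s := (Finset.mem_insert.1 hj).resolve_left hji
        have h1 : Q j * (Q i * A Q * P i) * P j = Q i * A Q * P i := by
          calc Q j * (Q i * A Q * P i) * P j = (Q j * Q i) * A Q * (P i * P j) := by noncomm_ring
            _ = Q i * (Q j * A Q * P j) * P i := by
              rw [hQ.anticomm j i hji, hP.anticomm i j (Ne.symm hji)]; noncomm_ring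
            _ = Q i * A Q * P i := by rw [hAs Q hQ j hjs]
        rw [h1, hAs Q hQ j hjs]

/-- Clifford systems near a given one are conjugate to it. -/
theorem eventually_orthogonallyConjugate
    {P : Fin (m + 1) → Matrix (Fin (2 * l)) (Fin (2 * l)) ℝ} (hP : IsCliffordSystem P) :
    {Q | IsCliffordSystem Q → OrthogonallyConjugate Q P} ∈ nhds P := by
  obtain ⟨A, hA, hA1, hAs⟩ := exists_continuous_intertwiner hP Finset.univ
  have h1 : ∀ᶠ Q in nhds P, (A Q).det ≠ 0 :=
    (hA.matrix_det.continuousAt).eventually_ne (by simp [hA1])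
  filter_upwards [h1] with Q hQ0 hQ
  have h2 : ∀ i, Q i * A Q = A Q * P i := by
    intro i
    conv_rhs => rw [← hAs Q hQ i (Finset.mem_univ i)]
    rw [Matrix.mul_assoc, Matrix.mul_assoc, hP.sq_eq_one, Matrix.mul_one]
  obtain ⟨U, hU, hUi⟩ := orthogonallyConjugate_of_intertwiner hP.isSymm hQ.isSymm
    (isUnit_iff_ne_zero.2 hQ0) h2
  have hU' : U * Uᵀ = 1 := mul_eq_one_comm.1 hU
  refine ⟨Uᵀ, by rwa [Matrix.transpose_transpose], fun i => ?_⟩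
  have := congrArg Matrix.transpose (hUi i)
  rw [Matrix.transpose_mul, Matrix.transpose_mul, (hP.isSymm i).eq, (hQ.isSymm i).eq] at this
  exact this.symm

/-- A symmetric involution is orthogonal, so its rows are unit vectors. This gives the boundedness
needed for compactness. -/
theorem abs_apply_le_one {N : ℕ} {B : Matrix (Fin N) (Fin N) ℝ} (hB : B.IsSymm) (h : B * B = 1)
    (a b : Fin N) : |B a b| ≤ 1 := by
  have h1 : ∑ c, B a c ^ 2 = 1 := by
    have h2 := congrFun (congrFun h a) a
    rw [Matrix.mul_apply, Matrix.one_apply_eq] at h2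
    rw [← h2]
    exact Finset.sum_congr rfl fun c _ => by rw [hB.apply, sq]
  rw [← sq_le_one_iff_abs_le_one, ← h1]
  exact Finset.single_le_sum (f := fun c => B a c ^ 2) (fun _ _ => sq_nonneg _) (Finset.mem_univ b)

theorem isCompact_setOf_isCliffordSystem (m l : ℕ) :
    IsCompact {P : Fin (m + 1) → Matrix (Fin (2 * l)) (Fin (2 * l)) ℝ | IsCliffordSystem P} := by
  have hK : IsCompact (Set.univ.pi fun _ : Fin (m + 1) => Set.univ.pi fun _ : Fin (2 * l) =>
      Set.univ.pi fun _ : Fin (2 * l) => Set.Icc (-1 : ℝ) 1) :=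
    isCompact_univ_pi fun _ => isCompact_univ_pi fun _ => isCompact_univ_pi fun _ => isCompact_Icc
  refine IsCompact.of_isClosed_subset hK ?_ ?_
  · have h1 : {P : Fin (m + 1) → Matrix (Fin (2 * l)) (Fin (2 * l)) ℝ | IsCliffordSystem P} =
        (⋂ i, {P | (P i)ᵀ = P i}) ∩ (⋂ i, {P | P i * P i = 1}) ∩
          ⋂ i, ⋂ j, ⋂ _ : i ≠ j, {P | P i * P j = -(P j * P i)} := by
      ext P
      simp only [Set.mem_inter_iff, Set.mem_iInter, Set.mem_ofPred_eq]
      exact ⟨fun h => ⟨⟨h.isSymm, h.sq_eq_one⟩, h.anticomm⟩, fun h => ⟨h.1.1, h.1.2, h.2⟩⟩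
    have hc : ∀ i, Continuous
        fun P : Fin (m + 1) → Matrix (Fin (2 * l)) (Fin (2 * l)) ℝ => P i := continuous_apply
    rw [h1]
    refine ((isClosed_iInter fun i => ?_).inter (isClosed_iInter fun i => ?_)).inter
      (isClosed_iInter fun i => isClosed_iInter fun j => isClosed_iInter fun _ => ?_)
    · exact isClosed_eq (hc i).matrix_transpose (hc i)
    · exact isClosed_eq ((hc i).matrix_mul (hc i)) continuous_const
    · exact isClosed_eq ((hc i).matrix_mul (hc j)) ((hc j).matrix_mul (hc i)).neg
  · intro P hP i _ a _ b _
    exact abs_le.1 (abs_apply_le_one (hP.isSymm i) (hP.sq_eq_one i) a b)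

/-- There are finitely many Clifford systems of given size up to orthogonal conjugation. -/
theorem exists_finset_orthogonallyConjugate (m l : ℕ) :
    ∃ t : Finset (Fin (m + 1) → Matrix (Fin (2 * l)) (Fin (2 * l)) ℝ),
      (∀ P ∈ t, IsCliffordSystem P) ∧
        ∀ Q, IsCliffordSystem Q → ∃ P ∈ t, OrthogonallyConjugate Q P := by
  obtain ⟨t, ht, hcover⟩ := (isCompact_setOf_isCliffordSystem m l).elim_nhds_subcover
    (fun P => {Q | IsCliffordSystem Q → OrthogonallyConjugate Q P})
    fun P hP => eventually_orthogonallyConjugate hP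
  refine ⟨t, ht, fun Q hQ => ?_⟩
  obtain ⟨P, hP, hQP⟩ := Set.mem_iUnion₂.1 (hcover hQ)
  exact ⟨P, hP, hQP hQ⟩

theorem dotProduct_mulVec_mulVec {N : ℕ} {U : Matrix (Fin N) (Fin N) ℝ} (hU : Uᵀ * U = 1)
    (x y : Fin N → ℝ) : (U *ᵥ x) ⬝ᵥ (U *ᵥ y) = x ⬝ᵥ y := by
  rw [Matrix.dotProduct_mulVec, Matrix.vecMul_mulVec, ← Matrix.dotProduct_mulVec, hU, Matrix.one_mulVec]

/-- Orthogonally conjugate Clifford systems have congruent foliations. -/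
theorem Foliation.congruent_of_orthogonallyConjugate (F : Foliation)
    {Q : Fin (F.m + 1) → Matrix (Fin (2 * F.l)) (Fin (2 * F.l)) ℝ} (hQ : IsCliffordSystem Q)
    (h : OrthogonallyConjugate F.P Q) :
    F.Congruent ⟨F.m, F.l, F.one_le_m, F.one_le_l, Q, hQ⟩ := by
  obtain ⟨U, hU, hUi⟩ := h
  have hnorm : ∀ x, ‖Matrix.toEuclideanLin U x‖ = ‖x‖ := by
    intro x
    rw [← sq_eq_sq₀ (norm_nonneg _) (norm_nonneg _), EuclideanSpace.real_norm_sq_eq,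
      EuclideanSpace.real_norm_sq_eq]
    simpa [dotProduct, sq] using dotProduct_mulVec_mulVec hU x.ofLp x.ofLp
  let A : EuclideanSpace ℝ (Fin (2 * F.l)) ≃ₗᵢ[ℝ] EuclideanSpace ℝ (Fin (2 * F.l)) :=
    LinearIsometry.toLinearIsometryEquiv ⟨Matrix.toEuclideanLin U, hnorm⟩ rfl
  have hAx : ∀ x, (A x).ofLp = U *ᵥ x.ofLp := fun x => rfl
  have hpoly : ∀ x, fkmPolynomial Q (A x) = fkmPolynomial F.P x := by
    intro x
    refine Finset.sum_congr rfl fun i _ => ?_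
    rw [hAx, Matrix.mulVec_mulVec, hUi, ← Matrix.mulVec_mulVec, dotProduct_mulVec_mulVec hU]
  have hlevel : ∀ c, A '' levelSet F.P c = levelSet Q c := by
    intro c
    ext y
    constructor
    · rintro ⟨x, ⟨hx, hxc⟩, rfl⟩
      exact ⟨by simpa using hx, (hpoly x).trans hxc⟩
    · rintro ⟨hy, hyc⟩
      refine ⟨A.symm y, ⟨by simpa using hy, ?_⟩, A.apply_symm_apply y⟩
      rw [← hpoly, A.apply_symm_apply, hyc]
  refine ⟨A, ?_⟩
  ext L
  constructor
  · rintro ⟨_, ⟨hne, c, rfl⟩, rfl⟩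
    exact ⟨hne.image A, c, hlevel c⟩
  · rintro ⟨hne, c, rfl⟩
    refine ⟨levelSet F.P c, ⟨?_, c, rfl⟩, hlevel c⟩
    rw [← Set.image_nonempty (f := A), hlevel]
    exact hne

theorem exists_finite_congruent (m l : ℕ) :
    ∃ S : Set Foliation, S.Finite ∧
      ∀ F : Foliation, F.m = m → F.l = l → ∃ G ∈ S, F.Congruent G := by
  obtain ⟨t, ht, hcover⟩ := exists_finset_orthogonallyConjugate m l
  refine ⟨{G | ∃ h1 : 1 ≤ m, ∃ h2 : 1 ≤ l, ∃ P : t, G = ⟨m, l, h1, h2, P.1, ht P.1 P.2⟩}, ?_, ?_⟩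
  · by_cases h : 1 ≤ m ∧ 1 ≤ l
    · refine (Set.finite_range fun P : t =>
        (⟨m, l, h.1, h.2, P.1, ht P.1 P.2⟩ : Foliation)).subset ?_
      rintro G ⟨_, _, P, rfl⟩
      exact ⟨P, rfl⟩
    · refine Set.finite_empty.subset ?_
      rintro G ⟨h1, h2, -⟩
      exact h ⟨h1, h2⟩
  · rintro F rfl rfl
    obtain ⟨P, hP, hFP⟩ := hcover F.P F.isCliffordSystem
    exact ⟨_, ⟨F.one_le_m, F.one_le_l, ⟨P, hP⟩, rfl⟩,
      F.congruent_of_orthogonallyConjugate (ht P hP) hFP⟩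

end Rigidity

/-! ### Translation to matrices and numerical bounds. -/

section Main

variable {m l : ℕ} {P : Fin (m + 1) → Matrix (Fin (2 * l)) (Fin (2 * l)) ℝ}

theorem toEuclideanLin_toEuclideanLin {N : ℕ} (B C : Matrix (Fin N) (Fin N) ℝ)
    (x : EuclideanSpace ℝ (Fin N)) :
    Matrix.toEuclideanLin B (Matrix.toEuclideanLin C x) = Matrix.toEuclideanLin (B * C) x := by
  simp [Matrix.toLpLin_apply]

theorem IsCliffordSystem.isCliffordFamily (hP : IsCliffordSystem P) :
    IsCliffordFamily fun i => Matrix.toEuclideanLin (P i) where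
  isSymmetric i := Matrix.isSymmetric_toEuclideanLin_iff.2 (by
    rw [Matrix.IsHermitian, Matrix.conjTranspose_eq_transpose_of_trivial]
    exact hP.isSymm i)
  apply_apply i x := by
    rw [toEuclideanLin_toEuclideanLin, hP.sq_eq_one]; simp
  anticomm i j hij x := by
    rw [toEuclideanLin_toEuclideanLin, toEuclideanLin_toEuclideanLin, hP.anticomm i j hij]
    simp

theorem cliffordStiefel_eq_stiefel (P : Fin (m + 1) → Matrix (Fin (2 * l)) (Fin (2 * l)) ℝ) :
    cliffordStiefel P = stiefel fun i => Matrix.toEuclideanLin (P i) := by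
  ext x
  have h1 : ∀ i, inner ℝ (Matrix.toEuclideanLin (P i) x) x = x.ofLp ⬝ᵥ (P i *ᵥ x.ofLp) := by
    intro i
    rw [EuclideanSpace.inner_eq_star_dotProduct]
    simp [Matrix.toLpLin_apply]
  have h2 : fkmPolynomial P x = 0 ↔ ∀ i, x.ofLp ⬝ᵥ (P i *ᵥ x.ofLp) = 0 := by
    rw [fkmPolynomial, Finset.sum_eq_zero_iff_of_nonneg fun _ _ => sq_nonneg _]
    simp
  simp only [cliffordStiefel, levelSet, stiefel, Set.mem_ofPred_eq, h1, h2,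
    mem_sphere_zero_iff_norm]

theorem IsCliffordSystem.delta_dvd (hm : 1 ≤ m) (hP : IsCliffordSystem P) : delta m ∣ l := by
  obtain ⟨r, rfl⟩ : ∃ r, m = r + 1 := ⟨m - 1, by omega⟩
  have hA := hP.isCliffordFamily
  have h1 := IsAnticommutingFamily.two_mul_delta_dvd r ⟨hA.apply_apply, hA.anticomm⟩
  rw [finrank_euclideanSpace_fin] at h1
  exact Nat.dvd_of_mul_dvd_mul_left two_pos h1

theorem delta_pos (m : ℕ) : 0 < delta m := by
  by_cases h : 10 ≤ m
  · obtain ⟨r, rfl⟩ := Nat.exists_eq_add_of_le' h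
    have := lt_four_mul_delta r
    omega
  · interval_cases m <;> norm_num [delta]

theorem InRange.lt {k : ℕ} (h : InRange m l k) : 7 * m + 14 < 4 * l := by
  obtain ⟨h1, h2⟩ := h
  have hd : (0 : ℝ) < delta m := by exact_mod_cast delta_pos m
  rw [gt_iff_lt, div_lt_iff₀ (by positivity)] at h2
  have h3 : (7 * m + 14 : ℝ) < 4 * l := by
    rw [h1]; push_cast; linarith
  exact_mod_cast h3

theorem le_of_not_inRange {k : ℕ} (hl : l = k * delta m) (h : ¬InRange m l k) :
    4 * l ≤ 7 * m + 14 := by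
  have hd : (0 : ℝ) < delta m := by exact_mod_cast delta_pos m
  have h2 : (k : ℝ) ≤ (7 * (m : ℝ) + 14) / (4 * (delta m : ℝ)) :=
    not_lt.1 fun h' => h ⟨hl, h'⟩
  rw [le_div_iff₀ (by positivity)] at h2
  have h3 : (4 * l : ℝ) ≤ 7 * m + 14 := by
    rw [hl]; push_cast; linarith
  exact_mod_cast h3

/-- A foliation out of range has bounded parameters. -/
theorem Foliation.lt_of_not_inRange (F : Foliation) (h : ¬∃ k : ℕ, InRange F.m F.l k) :
    F.m < 10 ∧ F.l < 20 := by
  obtain ⟨k, hk⟩ := F.isCliffordSystem.delta_dvd F.one_le_m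
  rw [mul_comm] at hk
  have h1 := le_of_not_inRange hk fun hr => h ⟨k, hr⟩
  have h2 : delta F.m ≤ F.l := Nat.le_of_dvd F.one_le_l ⟨k, by rw [hk, mul_comm]⟩
  have h3 : F.m < 10 := by
    by_contra! h10
    obtain ⟨r, hr⟩ := Nat.exists_eq_add_of_le' h10
    have := lt_four_mul_delta r
    rw [← hr] at this
    omega
  -- `m ≤ 9` gives `4l ≤ 77`, hence `l ≤ 19`.
  exact ⟨h3, by omega⟩

end Main

end FKM

end

theorem corollaryC :
    (∀ (m l k : ℕ) (P : Fin (m + 1) → Matrix (Fin (2 * l)) (Fin (2 * l)) ℝ),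
      1 ≤ m → FKM.IsCliffordSystem P → FKM.InRange m l k →
        (FKM.cliffordStiefel P).Nonempty ∧
        FKM.IsSmoothSubmanifold (2 * l - m - 2) (FKM.cliffordStiefel P) ∧
        FKM.ACSNegative (2 * l - m - 2) (FKM.cliffordStiefel P)) ∧
    (∃ S : Set FKM.Foliation, S.Finite ∧
      ∀ F : FKM.Foliation, (¬ ∃ k : ℕ, FKM.InRange F.m F.l k) →
        ∃ G ∈ S, F.Congruent G) := by
  constructor
  · intro m l k P hm hP hr
    have hlt := hr.lt
    have hA := hP.isCliffordFamily
    have : Nontrivial (Fin (m + 1)) := Fin.nontrivial_iff_two_le.2 (by omega)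
    rw [FKM.cliffordStiefel_eq_stiefel]
    -- With `n = 2l - m - 2` the largeness condition becomes `25m + 49 < 16l`, which follows from
    -- `28m + 56 < 16l`. The latter also keeps the natural subtraction from truncating.
    refine ⟨FKM.stiefel_nonempty hA ?_, FKM.isSmoothSubmanifold_stiefel hA ?_,
      FKM.acsNegative_stiefel hA (by omega) ?_ ?_⟩ <;>
    simp only [finrank_euclideanSpace_fin, Fintype.card_fin] <;> omega
  · choose S hS hcover using FKM.exists_finite_congruent
    refine ⟨⋃ m ∈ Set.Iio 10, ⋃ l ∈ Set.Iio 20, S m l,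
      (Set.finite_Iio 10).biUnion fun m _ => (Set.finite_Iio 20).biUnion fun l _ => hS m l,
      fun F hF => ?_⟩
    obtain ⟨h1, h2⟩ := F.lt_of_not_inRange hF
    obtain ⟨G, hG, hFG⟩ := hcover F.m F.l F rfl rfl
    exact ⟨G, Set.mem_biUnion h1 (Set.mem_biUnion h2 hG), hFG⟩
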